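/- Let $dA(z)=\frac1\pi\,dx\,dy$ be the normalized area measure on $\mathbb C$ and $d\lambda(z)=\frac12 e^{-|z|^2/2}\,dA(z)$ the Gaussian measure. Let $\mathcal F^2$ be the Fock space of all entire functions in $L^2(\mathbb C,d\lambda)$, a closed subspace with orthogonal projection $P:L^2(\mathbb C,d\lambda)\to\mathcal F^2$, reproducing kernel $K_z(w)=e^{\bar z w/2}$ and normalized reproducing kernel $k_z(w)=e^{\bar z w/2-|z|^2/4}$. Let $\varphi:\mathbb C\to\mathbb R$ be a bounded positive function, that is, $\varphi\in L^\infty(\mathbb C,dA)$ and $\varphi\ge 0$ almost everywhere, and let $d\mu=\varphi\,dA$. Let $T_\varphi f=P(\varphi f)$ be the Toeplitz operator on $\mathcal F^2$ and $\widetilde\varphi(z)=\int_{\mathbb C}\varphi\,|k_z|^2\,d\lambda$ the Berezin transform. Then $T_\varphi=T_\mu$, that is, $$T_\varphi f(z)=\frac12\int_{\mathbb C} f(w)\,\overline{K_z(w)}\,e^{-|w|^2/2}\,d\mu(w)\qquad(f\in\mathcal F^2,\ z\in\mathbb C)$$ with an absolutely convergent integral, and $\widetilde\varphi=\widetilde\mu$,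 that is, $\widetilde\varphi(z)=\frac12\int_{\mathbb C}|k_z(w)|^2e^{-|w|^2/2}\,d\mu(w)$ for all $z\in\mathbb C$. Moreover, the following statements are equivalent: (a) $T_\mu=T_\varphi$ is invertible on $\mathcal F^2$ (it has a bounded two-sided inverse); (b) $\widetilde\mu=\widetilde\varphi$ is bounded below on $\mathbb C$: there is $\delta>0$ with $\widetilde\varphi(z)\ge\delta$ for all $z\in\mathbb C$; (c) there is an $r>0$ such that $\chi_{\{z\in\mathbb C:\varphi(z)>r\}}\,dA$ is a reverse Carleson measure for $\mathcal F^2$ (equivalently, for some $C>0$, $\int_{\{\varphi>r\}}|f|^2\,d\lambda\ge C\int_{\mathbb C}|f|^2\,d\lambda$ for all $f\in\mathcal F^2$); (d) $\mu$ is a reverse Carleson measure for $\mathcal F^2$; (e) $\mu$ satisfies the reverse Carleson condition for $\mathcal F^2$. Here a positive Borel measure $\nu$ on $\mathbb C$ is a reverse Carleson measure for $\mathcal F^2$ if there is a constant $C>0$ such that $\int_{\mathbb C}|f(w)|^2e^{-|w|^2/2}\,d\nu(w)\ge C\int_{\mathbb C}|f(w)|^2e^{-|w|^2/2}\,dA(w)$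 for all $f\in\mathcal F^2$; it satisfies the reverse Carleson condition for $\mathcal F^2$ if there are $r>0$ and $C>0$ such that $C^{-1}\le\nu(B(z,r))\le C$ for all $z\in\mathbb C$, where $B(z,r)=\{w:|w-z|<r\}$. -/

import Mathlib

open MeasureTheory Filter Topology
open scoped ENNReal ComplexConjugate

noncomputable section
namespace Fock

/-- The normalized area measure `dA = dx dy / π` on the complex plane. -/
def areaMeasure : Measure ℂ := ENNReal.ofReal (Real.pi)⁻¹ • volume

/-- The Gaussian measure `dλ(z) = (1/2) exp(-|z|²/2) dA(z)`. -/
def gaussianMeasure : Measure ℂ :=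
  areaMeasure.withDensity fun z => ENNReal.ofReal ((1 / 2) * Real.exp (-‖z‖ ^ 2 / 2))

theorem gaussianMeasure_absolutelyContinuous : gaussianMeasure ≪ areaMeasure :=
  withDensity_absolutelyContinuous _ _

theorem volume_absolutelyContinuous_area : (volume : Measure ℂ) ≪ areaMeasure :=
  Measure.absolutelyContinuous_smul (by simp [Real.pi_pos])

theorem area_absolutelyContinuous_gaussian : areaMeasure ≪ gaussianMeasure := by
  refine withDensity_absolutelyContinuous' ?_ ?_
  · exact Measurable.aemeasurable (by fun_prop)
  · refine Eventually.of_forall fun z => ?_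
    simp [Real.exp_pos]

instance isOpenPosMeasure_gaussian : gaussianMeasure.IsOpenPosMeasure :=
  (volume_absolutelyContinuous_area.trans area_absolutelyContinuous_gaussian).isOpenPosMeasure

theorem enorm_le_circle {G : ℂ → ℂ} (hG : Differentiable ℂ G) (z : ℂ) (r : ℝ) :
    ‖G z‖ₑ ≤ ∫⁻ t in Set.Ioo (-Real.pi) Real.pi, ‖G (circleMap z r t)‖ₑ := by
  have h1 : Real.circleAverage G z r = G z := hG.diffContOnCl.circleAverage
  rw [Real.circleAverage_eq_integral_add (-Real.pi)] at h1
  rw [intervalIntegral.integral_comp_add_right (fun t => G (circleMap z r t))] at h1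
  rw [← h1, enorm_smul, intervalIntegral.integral_of_le (by linarith [Real.pi_pos])]
  have h2 : ‖(2 * Real.pi)⁻¹‖ₑ ≤ 1 := by
    rw [Real.enorm_eq_ofReal (by positivity), ← ENNReal.ofReal_one]
    refine ENNReal.ofReal_le_ofReal (inv_le_one_of_one_le₀ ?_)
    linarith [Real.two_le_pi]
  refine (mul_le_mul' h2 (enorm_integral_le_lintegral_enorm _)).trans (le_of_eq ?_)
  rw [one_mul, show (0 : ℝ) + -Real.pi = -Real.pi by ring,
    show 2 * Real.pi + -Real.pi = Real.pi by ring, restrict_Ioo_eq_restrict_Ioc]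

theorem enorm_le_ball {G : ℂ → ℂ} (hG : Differentiable ℂ G) (z : ℂ) :
    ‖G z‖ₑ ≤ 4 * ∫⁻ w in Metric.ball z 1, ‖G w‖ₑ := by
  have hc := hG.continuous
  have e1 : ∫⁻ w in Metric.ball z 1, ‖G w‖ₑ
      = ∫⁻ w, (Metric.ball z 1).indicator (fun w => ‖G w‖ₑ) (z + w) := by
    rw [lintegral_add_left_eq_self, lintegral_indicator Metric.isOpen_ball.measurableSet]
  have e2 : ∫⁻ p in Set.Ioo (1 / 2 : ℝ) 1 ×ˢ Set.Ioo (-Real.pi) Real.pi,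
      ENNReal.ofReal (1 / 2) * ‖G (circleMap z p.1 p.2)‖ₑ
      ≤ ∫⁻ w in Metric.ball z 1, ‖G w‖ₑ := by
    rw [e1, ← Complex.lintegral_comp_polarCoord_symm]
    refine (setLIntegral_mono_ae' (g := fun p => ENNReal.ofReal p.1 •
        (Metric.ball z 1).indicator (fun w => ‖G w‖ₑ) (z + Complex.polarCoord.symm p))
      (measurableSet_Ioo.prod measurableSet_Ioo)
      (Eventually.of_forall ?_)).trans (lintegral_mono_set (μ := volume) ?_)
    · rintro ⟨r, t⟩ ⟨⟨hr1, hr2⟩, -⟩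
      simp only at hr1 hr2
      have h0 : z + Complex.polarCoord.symm (r, t) = circleMap z r t := by
        simp [circleMap, Complex.exp_mul_I]
      simp only [h0, smul_eq_mul]
      rw [Set.indicator_of_mem]
      · exact mul_le_mul' (ENNReal.ofReal_le_ofReal hr1.le) le_rfl
      · rw [Metric.mem_ball, dist_eq_norm, circleMap_sub_center]
        simp [abs_of_pos (show 0 < r by linarith), hr2]
    · exact Set.prod_mono (fun r hr => lt_trans (by norm_num) hr.1) subset_rfl
  have e3 : ENNReal.ofReal (1 / 2) * (‖G z‖ₑ * ENNReal.ofReal (1 / 2))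
      ≤ ∫⁻ w in Metric.ball z 1, ‖G w‖ₑ := by
    refine le_trans ?_ e2
    have hm : Measurable fun p : ℝ × ℝ => ‖G (circleMap z p.1 p.2)‖ₑ := by
      refine (Continuous.enorm (hc.comp ?_)).measurable
      unfold circleMap
      fun_prop
    rw [lintegral_const_mul _ hm, Measure.volume_eq_prod,
      ← Measure.prod_restrict, lintegral_prod _ hm.aemeasurable]
    refine mul_le_mul' le_rfl ?_
    calc ‖G z‖ₑ * ENNReal.ofReal (1 / 2)
        = ∫⁻ _ in Set.Ioo (1 / 2 : ℝ) 1, ‖G z‖ₑ := by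
          rw [setLIntegral_const, Real.volume_Ioo]
          norm_num
      _ ≤ _ := lintegral_mono fun r => enorm_le_circle hG z r
  calc ‖G z‖ₑ = 4 * (ENNReal.ofReal (1 / 2) * (‖G z‖ₑ * ENNReal.ofReal (1 / 2))) := by
        rw [mul_comm ‖G z‖ₑ, ← mul_assoc, ← mul_assoc,
          show (4 : ℝ≥0∞) = ENNReal.ofReal 4 by simp, ← ENNReal.ofReal_mul (by norm_num),
          ← ENNReal.ofReal_mul (by norm_num)]
        norm_num
    _ ≤ _ := mul_le_mul' le_rfl e3

/-- Point evaluations are bounded in the `L²(λ)` norm, uniformly on bounded sets. -/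
theorem exists_enorm_le_eLpNorm (R : ℝ) : ∃ C : ℝ≥0∞, C ≠ ∞ ∧ ∀ F : ℂ → ℂ, Differentiable ℂ F →
    ∀ z ∈ Metric.ball (0 : ℂ) R, ‖F z‖ₑ ≤ C * eLpNorm F 2 gaussianMeasure := by
  set d : ℝ := Real.pi⁻¹ * ((1 / 2) * Real.exp (-(R + 1) ^ 2 / 2)) with hd
  have hd0 : 0 < d := by positivity
  refine ⟨(4 * ENNReal.ofReal d⁻¹) ^ (1 / 2 : ℝ), ?_, fun F hF z hz => ?_⟩
  · exact ENNReal.rpow_ne_top_of_nonneg (by norm_num) (by finiteness)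
  have hR : ‖z‖ < R := by simpa using hz
  have h1 : ‖F z‖ₑ ^ 2 ≤ 4 * ∫⁻ w in Metric.ball z 1, ‖F w‖ₑ ^ 2 := by
    have := enorm_le_ball (G := fun w => F w ^ 2) (hF.pow 2) z
    simpa [enorm_pow] using this
  have h2 : ∫⁻ w in Metric.ball z 1, ‖F w‖ₑ ^ 2
      ≤ ENNReal.ofReal d⁻¹ * ∫⁻ w, ‖F w‖ₑ ^ 2 ∂gaussianMeasure := by
    have hm : Measurable fun w => ‖F w‖ₑ ^ 2 := by
      have := hF.continuous
      fun_prop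
    rw [gaussianMeasure, lintegral_withDensity_eq_lintegral_mul _ (by fun_prop) hm, areaMeasure,
      lintegral_smul_measure, smul_eq_mul, ← mul_assoc, ← lintegral_const_mul _ (by fun_prop)]
    refine le_trans (setLIntegral_mono_ae' Metric.isOpen_ball.measurableSet
      (Eventually.of_forall fun w hw => ?_)) (setLIntegral_le_lintegral _ _)
    have hw' : ‖w‖ ≤ R + 1 := by
      have : ‖w - z‖ < 1 := by simpa [dist_eq_norm] using hw
      calc ‖w‖ = ‖(w - z) + z‖ := by ring_nf
        _ ≤ ‖w - z‖ + ‖z‖ := norm_add_le _ _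
        _ ≤ R + 1 := by linarith
    simp only [Pi.mul_apply]
    rw [← mul_assoc, ← ENNReal.ofReal_mul (by positivity), ← ENNReal.ofReal_mul (by positivity)]
    refine le_mul_of_one_le_left zero_le ?_
    rw [← ENNReal.ofReal_one]
    refine ENNReal.ofReal_le_ofReal ?_
    have : d ≤ Real.pi⁻¹ * ((1 / 2) * Real.exp (-‖w‖ ^ 2 / 2)) := by
      rw [hd]; gcongr
    calc (1 : ℝ) = d⁻¹ * d := (inv_mul_cancel₀ hd0.ne').symm
      _ ≤ d⁻¹ * (Real.pi⁻¹ * ((1 / 2) * Real.exp (-‖w‖ ^ 2 / 2))) := by gcongr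
      _ = _ := by ring
  have h3 : ‖F z‖ₑ ^ 2 ≤ (4 * ENNReal.ofReal d⁻¹) * ∫⁻ w, ‖F w‖ₑ ^ 2 ∂gaussianMeasure := by
    rw [mul_assoc]
    exact h1.trans (mul_le_mul' le_rfl h2)
  rw [eLpNorm_eq_lintegral_rpow_enorm_toReal (by norm_num) (by norm_num)]
  simp only [ENNReal.toReal_ofNat, ENNReal.rpow_ofNat]
  rw [← ENNReal.mul_rpow_of_nonneg _ _ (by norm_num)]
  calc ‖F z‖ₑ = (‖F z‖ₑ ^ 2) ^ (1 / 2 : ℝ) := by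
        rw [← ENNReal.rpow_ofNat, ← ENNReal.rpow_mul]; norm_num
    _ ≤ _ := ENNReal.rpow_le_rpow h3 (by norm_num)

/-- The Fock space `𝓕²`: the subspace of `L²(ℂ, dλ)` formed by the (classes of) entire functions,
with the inner product of `L²(ℂ, dλ)`. -/
def fockSpace : Submodule ℂ (Lp ℂ 2 gaussianMeasure) where
  carrier := {f | ∃ F : ℂ → ℂ, Differentiable ℂ F ∧ ⇑f =ᵐ[gaussianMeasure] F}
  add_mem' := by
    rintro f g ⟨F, hF, hf⟩ ⟨G, hG, hg⟩
    exact ⟨F + G, hF.add hG, (Lp.coeFn_add f g).trans (hf.add hg)⟩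
  zero_mem' := ⟨0, differentiable_const 0, Lp.coeFn_zero _ _ _⟩
  smul_mem' := by
    rintro c f ⟨F, hF, hf⟩
    exact ⟨c • F, hF.const_smul c, (Lp.coeFn_smul c f).trans (hf.const_smul c)⟩

theorem isClosed_fockSpace : IsClosed (fockSpace : Set (Lp ℂ 2 gaussianMeasure)) := by
  refine isSeqClosed_iff_isClosed.mp fun f g hf hfg => ?_
  choose F hF hfF using hf
  have hcau : ∀ R : ℝ, UniformCauchySeqOn F atTop (Metric.ball 0 R) := by
    intro R
    obtain ⟨C, hC, hb⟩ := exists_enorm_le_eLpNorm R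
    rw [Metric.uniformCauchySeqOn_iff]
    intro ε hε
    obtain ⟨N, hN⟩ := Metric.cauchySeq_iff.mp hfg.cauchySeq (ε / (C.toReal + 1)) (by positivity)
    refine ⟨N, fun m hm n hn z hz => ?_⟩
    have h1 := hb (F m - F n) ((hF m).sub (hF n)) z hz
    have h2 : eLpNorm (F m - F n) 2 gaussianMeasure = eLpNorm (⇑(f m - f n)) 2 gaussianMeasure :=
      eLpNorm_congr_ae (((hfF m).sub (hfF n)).symm.trans (Lp.coeFn_sub _ _).symm)
    have h3 : ‖F m z - F n z‖ ≤ C.toReal * ‖f m - f n‖ := by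
      rw [h2, ← Lp.enorm_def] at h1
      have := ENNReal.toReal_mono (by finiteness) h1
      simpa [ENNReal.toReal_mul] using this
    rw [dist_eq_norm]
    have h4 : ‖f m - f n‖ < ε / (C.toReal + 1) := by
      simpa [dist_eq_norm] using hN m hm n hn
    have h5 : (C.toReal + 1) * ‖f m - f n‖ < ε := by
      rw [lt_div_iff₀ (by positivity)] at h4
      linarith
    nlinarith [norm_nonneg (f m - f n)]
  have hlim : ∀ z, ∃ l, Tendsto (fun n => F n z) atTop (𝓝 l) := by
    intro z
    refine cauchySeq_tendsto_of_complete ?_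
    exact ((hcau (‖z‖ + 1)).cauchySeq (x := z) (by simp))
  choose G hG using hlim
  have hloc : TendstoLocallyUniformlyOn F G atTop Set.univ := by
    rw [tendstoLocallyUniformlyOn_iff_forall_isCompact isOpen_univ]
    intro K _ hK
    obtain ⟨R, hR⟩ := hK.isBounded.subset_ball 0
    exact ((hcau R).tendstoUniformlyOn_of_tendsto fun z _ => hG z).mono hR
  refine ⟨G, ?_, ?_⟩
  · rw [← differentiableOn_univ]
    exact hloc.differentiableOn (Eventually.of_forall fun n => (hF n).differentiableOn) isOpen_univ
  · obtain ⟨ns, hns, hae⟩ := (tendstoInMeasure_of_tendsto_Lp hfg).exists_seq_tendsto_ae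
    have hall : ∀ᵐ z ∂gaussianMeasure, ∀ n, f n z = F n z := ae_all_iff.mpr hfF
    filter_upwards [hae, hall] with z hz hz'
    simp only [hz'] at hz
    exact tendsto_nhds_unique hz ((hG z).comp hns.tendsto_atTop)

instance completeSpace_fockSpace : CompleteSpace fockSpace :=
  isClosed_fockSpace.completeSpace_coe

/-- The entire function representing an element of the Fock space. It is unique, because the
Gaussian measure charges every nonempty open set and entire functions are continuous. -/
def entireRep (f : fockSpace) : ℂ → ℂ := Classical.choose f.2

theorem differentiable_entireRep (f : fockSpace) : Differentiable ℂ (entireRep f) :=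
  (Classical.choose_spec f.2).1

theorem coeFn_eq_entireRep (f : fockSpace) :
    ⇑(f : Lp ℂ 2 gaussianMeasure) =ᵐ[gaussianMeasure] entireRep f :=
  (Classical.choose_spec f.2).2

/-- Bounded symbols for the area measure are bounded symbols for the Gaussian measure. -/
theorem memLp_top_gaussian {φ : ℂ → ℂ} (hφ : MemLp φ ∞ areaMeasure) : MemLp φ ∞ gaussianMeasure :=
  ⟨hφ.1.mono_ac gaussianMeasure_absolutelyContinuous, by
    have := hφ.2
    rw [eLpNorm_exponent_top] at this ⊢
    exact (eLpNormEssSup_mono_measure _ gaussianMeasure_absolutelyContinuous).trans_lt this⟩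

/-- The Toeplitz operator `T_φ f = P (φ f)` on the Fock space, where `P` is the orthogonal
projection of `L²(ℂ, dλ)` onto the Fock space and `φ ∈ L^∞(ℂ, dA)`. -/
def toeplitz (φ : ℂ → ℂ) (hφ : MemLp φ ∞ areaMeasure) : fockSpace →L[ℂ] fockSpace :=
  fockSpace.orthogonalProjectionOnto ∘L
    (ContinuousLinearMap.mul ℂ ℂ).holderL gaussianMeasure ∞ 2 2
      ((memLp_top_gaussian hφ).toLp φ) ∘L fockSpace.subtypeL

/-- The reproducing kernel `K_z(w) = exp(z̄ w / 2)` of the Fock space. -/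
def kernel (z w : ℂ) : ℂ := Complex.exp (conj z * w / 2)

/-- The normalized reproducing kernel `k_z = K_z / ‖K_z‖`, where `‖K_z‖ = exp(|z|² / 4)`. -/
def normalizedKernel (z w : ℂ) : ℂ := Complex.exp (w * conj z / 2 - (‖z‖ : ℂ) ^ 2 / 4)

/-- The integrand `f(w) · conj (K_z(w)) · exp(-|w|²/2)` of the Toeplitz operator of a measure. -/
def toeplitzIntegrand (f : ℂ → ℂ) (z w : ℂ) : ℂ :=
  f w * conj (kernel z w) * (Real.exp (-‖w‖ ^ 2 / 2) : ℂ)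

/-- The Toeplitz operator of a measure,
`T_μ f(z) = (1/2) ∫ f(w) conj (K_z(w)) exp(-|w|²/2) dμ(w)`. -/
def toeplitzMeasure (μ : Measure ℂ) (f : ℂ → ℂ) (z : ℂ) : ℂ :=
  (1 / 2) * ∫ w, toeplitzIntegrand f z w ∂μ

/-- The Berezin transform `φ̃(z) = ∫ φ(w) |k_z(w)|² dλ(w)` of a function. -/
def berezin (φ : ℂ → ℝ) (z : ℂ) : ℝ :=
  ∫ w, φ w * ‖normalizedKernel z w‖ ^ 2 ∂gaussianMeasure

/-- The Berezin transform `μ̃(z) = (1/2) ∫ |k_z(w)|² exp(-|w|²/2) dμ(w)` of a positive measure. -/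
def berezinMeasure (μ : Measure ℂ) (z : ℂ) : ℝ≥0∞ :=
  (1 / 2) * ∫⁻ w, ‖normalizedKernel z w‖ₑ ^ 2 * ENNReal.ofReal (Real.exp (-‖w‖ ^ 2 / 2)) ∂μ

/-- `μ` is a reverse Carleson measure for the Fock space: for some `C > 0`,
`∫ |f|² exp(-|w|²/2) dμ ≥ C ∫ |f|² exp(-|w|²/2) dA` for all entire `f ∈ L²(ℂ, dλ)`. -/
def IsReverseCarleson (μ : Measure ℂ) : Prop :=
  ∃ C : ℝ, 0 < C ∧ ∀ f : ℂ → ℂ, Differentiable ℂ f → MemLp f 2 gaussianMeasure →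
    ENNReal.ofReal C *
        ∫⁻ w, ‖f w‖ₑ ^ 2 * ENNReal.ofReal (Real.exp (-‖w‖ ^ 2 / 2)) ∂areaMeasure ≤
      ∫⁻ w, ‖f w‖ₑ ^ 2 * ENNReal.ofReal (Real.exp (-‖w‖ ^ 2 / 2)) ∂μ

/-- The reverse Carleson condition for the Fock space: for some `r > 0` and `C > 0`,
`C⁻¹ ≤ μ(B(z, r)) ≤ C` for all `z`. -/
def ReverseCarlesonCondition (μ : Measure ℂ) : Prop :=
  ∃ r : ℝ, 0 < r ∧ ∃ C : ℝ, 0 < C ∧ ∀ z : ℂ,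
    ENNReal.ofReal C⁻¹ ≤ μ (Metric.ball z r) ∧ μ (Metric.ball z r) ≤ ENNReal.ofReal C

end Fock
end

/-!
Let `f` be in the Fock space. For a nonnegative bounded symbol,
`⟨T_φ f, f⟩ = ½ ∫ |f|² e^{-|w|²/2} dμ` and `‖T_φ f‖² ≤ ‖φ‖_∞ ⟨T_φ f, f⟩`, so `T_φ` is bounded
below exactly when `μ` is a reverse Carleson measure; as `T_φ` is then coercive, this is the same
as invertibility.

Testing on the unit vectors `k_z` bounds the Berezin transform below. The mass of
`|k_z|² e^{-|w|²/2}` is Gaussian around `z`, so the part of the Berezin integral far from `z` is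
negligible and `μ` has a uniform amount of mass in each disc of a fixed radius. Since `φ` is
bounded, some superlevel set `G` of `φ` then has a uniform amount of area in each such disc.

Such a `G` carries a fixed proportion of `∫ |f|² e^{-|w|²/2} dA` (Luecking's argument). The discs
on which this integral is much smaller than on an enlarged disc contribute at most half of the
total. On any other disc let `p` be a maximum point of `|f(w)| e^{-|w|²/4}`. The Weyl translate of
`f` moving `p` to the origin is an entire function `g` whose size near `0` is controlled by
`|g(0)|`, and the sub-mean value property of `log⁺ |g / (ε g(0))|` shows that `|g| < ε |g(0)|`
only on a set of area `O(1 / log ε⁻¹)`, which for small `ε` is less than half of the area of `G`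
in the disc.
-/

noncomputable section
namespace Fock

open Metric Set

theorem setLIntegral_ball_eq_lintegral_circleMap {u : ℂ → ℝ≥0∞} (hu : Measurable u) (c : ℂ)
    (ρ : ℝ) :
    ∫⁻ w in ball c ρ, u w = ∫⁻ r in Ioo 0 ρ,
      ENNReal.ofReal r * ∫⁻ t in Ioo (-Real.pi) Real.pi, u (circleMap c r t) := by
  have hcirc : Measurable fun p : ℝ × ℝ => circleMap c p.1 p.2 := by
    unfold circleMap
    fun_prop
  have hpolar : ∀ p : ℝ × ℝ, c + Complex.polarCoord.symm p = circleMap c p.1 p.2 := fun p => by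
    simp [circleMap, Complex.exp_mul_I]
  have hmem : ∀ r ∈ Ioi (0 : ℝ), ∀ t, circleMap c r t ∈ ball c ρ ↔ r ∈ Iio ρ := fun r hr t => by
    rw [mem_ball, dist_eq_norm, circleMap_sub_center, norm_circleMap_zero, abs_of_pos hr, mem_Iio]
  have hmeas : Measurable fun p : ℝ × ℝ =>
      ENNReal.ofReal p.1 * (ball c ρ).indicator u (circleMap c p.1 p.2) := by
    have := (hu.indicator (measurableSet_ball (x := c) (ε := ρ))).comp hcirc
    fun_prop
  calc ∫⁻ w in ball c ρ, u w
      = ∫⁻ p in Ioi (0 : ℝ) ×ˢ Ioo (-Real.pi) Real.pi,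
          ENNReal.ofReal p.1 * (ball c ρ).indicator u (circleMap c p.1 p.2) := by
        rw [← lintegral_indicator measurableSet_ball, ← lintegral_add_left_eq_self _ c,
          ← Complex.lintegral_comp_polarCoord_symm]
        simp only [hpolar, polarCoord_target, smul_eq_mul]
    _ = ∫⁻ r in Ioi 0, (Iio ρ).indicator (fun r => ENNReal.ofReal r *
          ∫⁻ t in Ioo (-Real.pi) Real.pi, u (circleMap c r t)) r := by
        rw [Measure.volume_eq_prod, ← Measure.prod_restrict, lintegral_prod _ hmeas.aemeasurable]
        refine setLIntegral_congr_fun measurableSet_Ioi fun r hr => ?_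
        simp only [indicator, hmem r hr]
        split_ifs
        · exact lintegral_const_mul _ (by fun_prop)
        · simp
    _ = _ := by
        rw [setLIntegral_indicator measurableSet_Iio, Iio_inter_Ioi]

theorem ofReal_mul_volume_ball_le_setLIntegral {u : ℂ → ℝ} (hu : Continuous u) (hu0 : 0 ≤ u)
    {c : ℂ} {ρ : ℝ} (hc : ∀ r ∈ Ioo 0 ρ, u c ≤ Real.circleAverage u c r) :
    ENNReal.ofReal (u c) * volume (ball c ρ) ≤ ∫⁻ w in ball c ρ, ENNReal.ofReal (u w) := by
  rw [← setLIntegral_one, setLIntegral_ball_eq_lintegral_circleMap measurable_const,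
    setLIntegral_ball_eq_lintegral_circleMap (by fun_prop), ← lintegral_const_mul' _ _ (by simp)]
  refine setLIntegral_mono' measurableSet_Ioo fun r hr => ?_
  have hint : Integrable (fun t => u (circleMap c r t))
      (volume.restrict (Ioo (-Real.pi) Real.pi)) :=
    ((hu.comp (continuous_circleMap c r)).integrableOn_Icc).mono_set Ioo_subset_Icc_self
  have hmean : u c * (2 * Real.pi) ≤ ∫ t in Ioo (-Real.pi) Real.pi, u (circleMap c r t) := by
    have h := hc r hr
    rw [Real.circleAverage_eq_integral_add (-Real.pi),
      intervalIntegral.integral_comp_add_right (fun t => u (circleMap c r t)), smul_eq_mul,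
      intervalIntegral.integral_of_le (by linarith [Real.pi_pos]), integral_Ioc_eq_integral_Ioo,
      le_inv_mul_iff₀ (by positivity)] at h
    ring_nf at h ⊢
    exact h
  rw [mul_left_comm]
  gcongr
  rw [setLIntegral_one, Real.volume_Ioo, ← ENNReal.ofReal_mul (hu0 c),
    ← ofReal_integral_eq_lintegral_ofReal hint (Eventually.of_forall fun _ => hu0 _)]
  exact ENNReal.ofReal_le_ofReal (by linarith)

theorem volume_eq_zero_mul_ofReal_le {u : ℂ → ℝ} (hu : Continuous u) (hu0 : 0 ≤ u) {c : ℂ}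
    {ρ b : ℝ} (hc : ∀ r ∈ Ioo 0 ρ, u c ≤ Real.circleAverage u c r)
    (hb : ∀ w ∈ ball c ρ, u w ≤ u c + b) :
    volume ({w | u w = 0} ∩ ball c ρ) * ENNReal.ofReal (u c) ≤
      volume (ball c ρ) * ENNReal.ofReal b := by
  set B := ball c ρ
  set S := {w | u w = 0}
  have hS : MeasurableSet S := (isClosed_eq hu continuous_const).measurableSet
  have hsplit : volume (S ∩ B) + volume (B \ S) = volume B := by
    rw [inter_comm, measure_inter_add_sdiff B hS]
  have hBS : volume (B \ S) ≤ volume B := measure_mono sdiff_subset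
  have hmean : ENNReal.ofReal (u c) * volume B ≤
      (ENNReal.ofReal (u c) + ENNReal.ofReal b) * volume (B \ S) :=
    calc ENNReal.ofReal (u c) * volume B
        ≤ ∫⁻ w in B, ENNReal.ofReal (u w) := ofReal_mul_volume_ball_le_setLIntegral hu hu0 hc
      _ = ∫⁻ w in B \ S, ENNReal.ofReal (u w) := by
          rw [← lintegral_inter_add_sdiff _ B hS, setLIntegral_congr_fun (g := fun _ => 0)
            (measurableSet_ball.inter hS) fun w hw => by simp [show u w = 0 from hw.2]]
          simp
      _ ≤ ∫⁻ _ in B \ S, (ENNReal.ofReal (u c) + ENNReal.ofReal b) :=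
          setLIntegral_mono' (measurableSet_ball.diff hS) fun w hw =>
            (ENNReal.ofReal_le_ofReal (hb w hw.1)).trans ENNReal.ofReal_add_le
      _ = _ := setLIntegral_const _ _
  have hfin : ENNReal.ofReal (u c) * volume (B \ S) ≠ ∞ :=
    ENNReal.mul_ne_top ENNReal.ofReal_ne_top (hBS.trans_lt measure_ball_lt_top).ne
  rw [← hsplit, mul_add, add_mul, add_comm, ENNReal.add_le_add_iff_left hfin] at hmean
  calc volume (S ∩ B) * ENNReal.ofReal (u c) = ENNReal.ofReal (u c) * volume (S ∩ B) := mul_comm _ _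
    _ ≤ ENNReal.ofReal b * volume (B \ S) := hmean
    _ ≤ volume B * ENNReal.ofReal b := by rw [mul_comm]; gcongr

theorem posLog_norm_le_circleAverage {h : ℂ → ℂ} {c : ℂ} {R : ℝ}
    (hh : AnalyticOnNhd ℂ h (closedBall c |R|)) :
    Real.posLog ‖h c‖ ≤ Real.circleAverage (fun w => Real.posLog ‖h w‖) c R := by
  rcases eq_or_ne R 0 with rfl | hR
  · simp
  have hmero : MeromorphicOn h (sphere c |R|) := (hh.mono sphere_subset_closedBall).meromorphicOn
  have hpos : CircleIntegrable (fun w => Real.posLog ‖h w‖) c R :=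
    hmero.circleIntegrable_posLog_norm
  have hnonneg : 0 ≤ Real.circleAverage (fun w => Real.posLog ‖h w‖) c R :=
    Real.circleAverage_nonneg_of_nonneg fun _ _ => Real.posLog_nonneg
  refine max_le hnonneg ?_
  rcases eq_or_ne (h c) 0 with h0 | h0
  · simpa [h0] using hnonneg
  calc Real.log ‖h c‖ ≤ Real.circleAverage (fun w => Real.log ‖h w‖) c R := by
        rw [hh.circleAverage_log_norm hR h0, le_add_iff_nonneg_left]
        refine finsum_nonneg fun u => ?_
        by_cases hu : u ∈ closedBall c |R|
        · refine mul_nonneg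
            (by exact_mod_cast MeromorphicOn.AnalyticOnNhd.divisor_nonneg hh u) ?_
          rw [← Real.log_abs, abs_mul, abs_inv, abs_norm, ← div_eq_mul_inv]
          rw [mem_closedBall', dist_eq_norm] at hu
          rcases (norm_nonneg (c - u)).eq_or_lt' with h0 | h0
          · simp [h0]
          · exact Real.log_nonneg ((one_le_div h0).mpr hu)
        · simp [Function.locallyFinsuppWithin.apply_eq_zero_of_notMem _ hu]
    _ ≤ _ := Real.circleAverage_mono hmero.circleIntegrable_log_norm hpos fun w _ =>
        le_max_right _ _

theorem volume_norm_lt_mul_ofReal_posLog_le {g : ℂ → ℂ} (hg : Differentiable ℂ g) {c : ℂ}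
    {ρ L ε : ℝ} (hε : 0 < ε) (hL : ∀ w ∈ ball c ρ, ‖g w‖ ≤ L * ‖g c‖) :
    volume ({w | ‖g w‖ < ε * ‖g c‖} ∩ ball c ρ) * ENNReal.ofReal (Real.posLog ε⁻¹) ≤
      volume (ball c ρ) * ENNReal.ofReal (Real.posLog L) := by
  rcases eq_or_ne (g c) 0 with h0 | h0
  · simp [h0, not_lt.mpr (norm_nonneg _)]
  set h : ℂ → ℂ := fun w => g w / (ε * g c)
  have hh : Differentiable ℂ h := hg.div_const _
  have hnorm : ∀ w, ‖h w‖ = ‖g w‖ / (ε * ‖g c‖) := fun w => by simp [h, abs_of_pos hε]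
  have hcenter : ‖h c‖ = ε⁻¹ := by rw [hnorm]; field_simp
  have hbound : ∀ w ∈ ball c ρ, Real.posLog ‖h w‖ ≤ Real.posLog ‖h c‖ + Real.posLog L :=
    fun w hw => by
      rw [hcenter]
      refine (Real.posLog_le_posLog (norm_nonneg _) ?_).trans Real.posLog_mul
      rw [hnorm, div_le_iff₀ (by positivity)]
      field_simp
      linarith [hL w hw]
  have hsub : {w | ‖g w‖ < ε * ‖g c‖} ⊆ {w | Real.posLog ‖h w‖ = 0} := fun w hw => by
    rw [mem_ofPred_eq, Real.posLog_eq_zero_iff, abs_norm, hnorm, div_le_one (by positivity)]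
    exact le_of_lt hw
  rw [← hcenter]
  refine le_trans (by gcongr) (volume_eq_zero_mul_ofReal_le (u := fun w => Real.posLog ‖h w‖)
    (Real.continuous_posLog.comp hh.continuous.norm) (fun _ => Real.posLog_nonneg)
    (fun r _ => posLog_norm_le_circleAverage fun w _ => hh.analyticAt w) hbound)

theorem exists_pos_volume_norm_lt_le (ρ L : ℝ) {δ : ℝ≥0∞} (hδ : δ ≠ 0) :
    ∃ ε : ℝ, 0 < ε ∧ ∀ g : ℂ → ℂ, Differentiable ℂ g → ∀ c,
      (∀ w ∈ ball c ρ, ‖g w‖ ≤ L * ‖g c‖) →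
      volume ({w | ‖g w‖ < ε * ‖g c‖} ∩ ball c ρ) ≤ δ := by
  set A := volume (ball (0 : ℂ) ρ) * ENNReal.ofReal (Real.posLog L)
  set T := (A / δ).toReal + 1
  have hT : 0 < T := by positivity
  have hAT : A ≤ δ * ENNReal.ofReal T := by
    rcases eq_or_ne δ ∞ with rfl | hδ'
    · simp [ENNReal.top_mul, hT]
    rw [mul_comm, ← ENNReal.div_le_iff hδ hδ', ENNReal.le_ofReal_iff_toReal_le _ hT.le]
    · simp [T]
    · exact ENNReal.div_ne_top (ENNReal.mul_ne_top measure_ball_lt_top.ne ENNReal.ofReal_ne_top) hδ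
  refine ⟨Real.exp (-T), Real.exp_pos _, fun g hg c hL => ?_⟩
  have h := volume_norm_lt_mul_ofReal_posLog_le hg (Real.exp_pos (-T)) hL
  rw [← Real.exp_neg, neg_neg, Real.posLog_eq_log
    (by rw [abs_of_pos (Real.exp_pos T)]; exact Real.one_le_exp hT.le), Real.log_exp,
    Measure.addHaar_ball_center] at h
  exact (ENNReal.mul_le_mul_iff_left (by simpa using hT) ENNReal.ofReal_ne_top).mp (h.trans hAT)

section Balls

variable {E : Type*} [NormedAddCommGroup E] [MeasurableSpace E] [BorelSpace E]

theorem setLIntegral_ball_comp_add_right {μ : Measure E} [μ.IsAddRightInvariant] (u : E → ℝ≥0∞)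
    (p : E) (r : ℝ) :
    ∫⁻ w in ball 0 r, u (w + p) ∂μ = ∫⁻ w in ball p r, u w ∂μ := by
  have hball : (· + p) ⁻¹' ball p r = ball (0 : E) r := by
    ext w
    simp [dist_eq_norm]
  rw [← hball, (measurePreserving_add_right μ p).setLIntegral_comp_preimage_emb
    (measurableEmbedding_addRight p)]

variable [ProperSpace E]

theorem measurableSet_dist_lt_prod (ρ : ℝ) : MeasurableSet {p : E × E | dist p.2 p.1 < ρ} :=
  (isOpen_lt (by fun_prop) continuous_const).measurableSet

theorem measurable_setLIntegral_ball (ν : Measure E) [SFinite ν] {u : E → ℝ≥0∞}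
    (hu : Measurable u) (ρ : ℝ) : Measurable fun z => ∫⁻ w in ball z ρ, u w ∂ν := by
  have h := ((hu.comp measurable_snd).indicator
    (measurableSet_dist_lt_prod ρ)).lintegral_prod_right' (ν := ν)
  convert h using 2 with z
  rw [← lintegral_indicator measurableSet_ball]
  rfl

variable {μ : Measure E} [μ.IsAddHaarMeasure]

theorem lintegral_setLIntegral_ball (ν : Measure E) [SFinite ν] {u : E → ℝ≥0∞}
    (hu : Measurable u) (ρ : ℝ) :
    ∫⁻ z, ∫⁻ w in ball z ρ, u w ∂ν ∂μ = μ (ball 0 ρ) * ∫⁻ w, u w ∂ν := by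
  have hball : ∀ z, ∫⁻ w in ball z ρ, u w ∂ν =
      ∫⁻ w, {p : E × E | dist p.2 p.1 < ρ}.indicator (fun p => u p.2) (z, w) ∂ν := fun z => by
    rw [← lintegral_indicator measurableSet_ball]
    rfl
  have hfiber : ∀ w, ∫⁻ z, {p : E × E | dist p.2 p.1 < ρ}.indicator (fun p => u p.2) (z, w) ∂μ =
      μ (ball 0 ρ) * u w := fun w => by
    calc _ = ∫⁻ z, (ball w ρ).indicator (fun _ => u w) z ∂μ := by
          refine lintegral_congr fun z => ?_
          simp only [indicator, mem_ofPred_eq, mem_ball, dist_comm w z]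
      _ = μ (ball 0 ρ) * u w := by
          rw [lintegral_indicator measurableSet_ball, setLIntegral_const, mul_comm,
            Measure.addHaar_ball_center]
  simp only [hball]
  rw [lintegral_lintegral_swap (by
    exact ((hu.comp measurable_snd).indicator (measurableSet_dist_lt_prod ρ)).aemeasurable)]
  simp only [hfiber]
  exact lintegral_const_mul _ hu

theorem mul_lintegral_le_two_mul_setLIntegral_of_doubling {u : E → ℝ≥0∞} (hu : Measurable u)
    (hfin : ∫⁻ w, u w ∂μ ≠ ∞) {G : Set E} {R R' : ℝ} (hR : 0 < R) (hR' : 0 < R') {c : ℝ≥0∞}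
    (hc : c ≠ ∞)
    (hG : ∀ z, μ (ball 0 R) * ∫⁻ w in ball z R', u w ∂μ ≤
        2 * μ (ball 0 R') * ∫⁻ w in ball z R, u w ∂μ →
      c * ∫⁻ w in ball z R, u w ∂μ ≤ ∫⁻ w in G ∩ ball z R, u w ∂μ) :
    c * ∫⁻ w, u w ∂μ ≤ 2 * ∫⁻ w in G, u w ∂μ := by
  set v := μ (ball 0 R)
  set V := μ (ball 0 R')
  set I := ∫⁻ w, u w ∂μ
  set J := ∫⁻ w in G, u w ∂μ
  have hv0 : v ≠ 0 := (measure_ball_pos _ _ hR).ne'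
  have hV0 : V ≠ 0 := (measure_ball_pos _ _ hR').ne'
  have hv : v ≠ ∞ := measure_ball_lt_top.ne
  have hV : V ≠ ∞ := measure_ball_lt_top.ne
  -- Either the ball at `z` is doubling and `hG` applies, or its integral is paid for by the larger
  -- ball; after averaging over `z` these larger balls account for at most half of `c * I`.
  have hlocal : ∀ z, 2 * V * (c * ∫⁻ w in ball z R, u w ∂μ) ≤
      2 * V * (∫⁻ w in ball z R, u w ∂(μ.restrict G)) + c * v * ∫⁻ w in ball z R', u w ∂μ := by
    intro z
    rw [Measure.restrict_restrict measurableSet_ball, inter_comm]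
    rcases le_total (v * ∫⁻ w in ball z R', u w ∂μ) (2 * V * ∫⁻ w in ball z R, u w ∂μ) with h | h
    · exact le_add_right (mul_le_mul_right (hG z h) _)
    · refine le_add_left ?_
      rw [mul_left_comm, mul_assoc c]
      exact mul_le_mul_right h _
  have hglobal := lintegral_mono (μ := μ) hlocal
  rw [lintegral_const_mul' _ _ (by finiteness), lintegral_const_mul' _ _ hc,
    lintegral_add_left ((measurable_setLIntegral_ball _ hu R).const_mul _),
    lintegral_const_mul' _ _ (by finiteness), lintegral_const_mul' _ _ (by finiteness),
    lintegral_setLIntegral_ball _ hu, lintegral_setLIntegral_ball _ hu,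
    lintegral_setLIntegral_ball _ hu] at hglobal
  have hcancel : V * v * (c * I) + V * v * (c * I) ≤ V * v * (2 * J) + V * v * (c * I) := by
    convert hglobal using 1 <;> ring
  rw [ENNReal.add_le_add_iff_right (by finiteness)] at hcancel
  exact (ENNReal.mul_le_mul_iff_right (mul_ne_zero hV0 hv0) (by finiteness)).mp hcancel

end Balls

theorem mul_half_le_setLIntegral_of_measure_lt_le {α : Type*} [MeasurableSpace α] {μ : Measure α}
    {u : α → ℝ≥0∞} (hu : Measurable u) {S : Set α} {a δ : ℝ≥0∞} (hδ : δ ≠ ∞) (hS : δ ≤ μ S)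
    (ha : μ ({x | u x < a} ∩ S) ≤ δ / 2) : a * (δ / 2) ≤ ∫⁻ x in S, u x ∂μ := by
  have hlt : MeasurableSet {x | u x < a} := measurableSet_lt hu measurable_const
  have hge : δ / 2 ≤ μ.restrict S {x | a ≤ u x} := by
    have hsplit : δ / 2 + δ / 2 ≤ μ.restrict S {x | a ≤ u x} + δ / 2 :=
      calc δ / 2 + δ / 2 = δ := ENNReal.add_halves δ
        _ ≤ μ.restrict S univ := by rwa [Measure.restrict_apply_univ]
        _ = μ.restrict S {x | a ≤ u x} + μ.restrict S {x | u x < a} := by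
            rw [← measure_add_measure_compl hlt, add_comm, compl_ofPred]
            simp only [not_lt]
        _ ≤ μ.restrict S {x | a ≤ u x} + δ / 2 := by
            rw [Measure.restrict_apply hlt]
            gcongr
    exact (ENNReal.add_le_add_iff_right (by finiteness)).mp hsplit
  exact (mul_le_mul_right hge a).trans (mul_meas_ge_le_lintegral hu a)

theorem eLpNorm_two_sq {α E : Type*} [MeasurableSpace α] [TopologicalSpace E] [ContinuousENorm E]
    (f : α → E) (μ : Measure α) : eLpNorm f 2 μ ^ 2 = ∫⁻ x, ‖f x‖ₑ ^ 2 ∂μ := by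
  simpa using eLpNorm_nnreal_pow_eq_lintegral (f := f) (μ := μ) (p := 2) two_ne_zero

/-- The function `f(w) exp(-|w|² / 4)`, whose squared modulus is the density that the Fock space
norm integrates against `dA`. -/
def weighted (f : ℂ → ℂ) (w : ℂ) : ℂ := f w * (Real.exp (-‖w‖ ^ 2 / 4) : ℂ)

theorem norm_weighted (f : ℂ → ℂ) (w : ℂ) :
    ‖weighted f w‖ = ‖f w‖ * Real.exp (-‖w‖ ^ 2 / 4) := by
  rw [weighted, norm_mul, Complex.norm_real, Real.norm_of_nonneg (Real.exp_pos _).le]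

theorem enorm_weighted_sq (f : ℂ → ℂ) (w : ℂ) :
    ‖weighted f w‖ₑ ^ 2 = ‖f w‖ₑ ^ 2 * ENNReal.ofReal (Real.exp (-‖w‖ ^ 2 / 2)) := by
  rw [← ofReal_norm, norm_weighted, ENNReal.ofReal_mul (norm_nonneg _), mul_pow, ofReal_norm,
    ← ENNReal.ofReal_pow (Real.exp_pos _).le, ← Real.exp_nat_mul]
  ring_nf

theorem norm_eq_exp_mul_norm_weighted (f : ℂ → ℂ) (w : ℂ) :
    ‖f w‖ = Real.exp (‖w‖ ^ 2 / 4) * ‖weighted f w‖ := by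
  rw [norm_weighted, mul_left_comm, ← Real.exp_add]
  ring_nf
  simp

theorem weighted_zero (f : ℂ → ℂ) : weighted f 0 = f 0 := by simp [weighted]

theorem continuous_weighted {f : ℂ → ℂ} (hf : Continuous f) : Continuous (weighted f) := by
  unfold weighted
  fun_prop

/-- The Weyl translate of `f` by `z`, which is entire when `f` is and whose weighted modulus is the
translate of that of `f`. -/
def weyl (z : ℂ) (f : ℂ → ℂ) (w : ℂ) : ℂ :=
  f (w + z) * Complex.exp (-(conj z * w) / 2 - (‖z‖ : ℂ) ^ 2 / 4)

theorem differentiable_weyl (z : ℂ) {f : ℂ → ℂ} (hf : Differentiable ℂ f) :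
    Differentiable ℂ (weyl z f) := by
  unfold weyl
  fun_prop

theorem norm_weighted_weyl (z : ℂ) (f : ℂ → ℂ) (w : ℂ) :
    ‖weighted (weyl z f) w‖ = ‖weighted f (w + z)‖ := by
  rw [norm_weighted, norm_weighted, weyl, norm_mul, mul_assoc, Complex.norm_exp, ← Real.exp_add]
  have h : ((‖z‖ : ℂ) ^ 2).re = ‖z‖ ^ 2 := by norm_cast
  simp only [Complex.sub_re, Complex.div_ofNat_re, h, Complex.neg_re, Complex.mul_re,
    Complex.conj_re, Complex.conj_im, Complex.sq_norm, Complex.normSq_apply, Complex.add_re,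
    Complex.add_im]
  congr 2
  ring

theorem norm_weyl_zero (z : ℂ) (f : ℂ → ℂ) : ‖weyl z f 0‖ = ‖weighted f z‖ := by
  rw [← weighted_zero (weyl z f), norm_weighted_weyl, zero_add]

theorem norm_weyl_le (z : ℂ) (f : ℂ → ℂ) {w : ℂ} {ρ : ℝ} (hw : w ∈ ball (0 : ℂ) ρ) :
    ‖weyl z f w‖ ≤ Real.exp (ρ ^ 2 / 4) * ‖weighted f (w + z)‖ := by
  have hwρ : ‖w‖ ≤ ρ := (mem_ball_zero_iff.mp hw).le
  rw [norm_eq_exp_mul_norm_weighted, norm_weighted_weyl]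
  gcongr

theorem enorm_weighted_sq_le_setLIntegral {f : ℂ → ℂ} (hf : Differentiable ℂ f) (p : ℂ) :
    ‖weighted f p‖ₑ ^ 2 ≤
      4 * ENNReal.ofReal (Real.exp (1 / 2)) * ∫⁻ w in ball p 1, ‖weighted f w‖ₑ ^ 2 := by
  set g := weyl p f
  have hg : Differentiable ℂ g := differentiable_weyl p hf
  have hweight : ∀ w ∈ ball (0 : ℂ) 1,
      ‖g w ^ 2‖ₑ ≤ ENNReal.ofReal (Real.exp (1 / 2)) * ‖weighted f (w + p)‖ₑ ^ 2 := fun w hw => by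
    have hexp : Real.exp (1 / 2) = Real.exp (1 ^ 2 / 4) ^ 2 := by
      rw [← Real.exp_nat_mul]
      norm_num
    rw [enorm_pow, hexp, ENNReal.ofReal_pow (Real.exp_pos _).le, ← mul_pow, ← ofReal_norm,
      ← ofReal_norm (weighted _ _), ← ENNReal.ofReal_mul (Real.exp_pos _).le]
    gcongr
    exact norm_weyl_le p f hw
  calc ‖weighted f p‖ₑ ^ 2 = ‖g 0 ^ 2‖ₑ := by
        rw [enorm_pow, ← ofReal_norm, ← norm_weyl_zero, ofReal_norm]
    _ ≤ 4 * ∫⁻ w in ball 0 1, ‖g w ^ 2‖ₑ :=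
        enorm_le_ball (G := fun w => g w ^ 2) (hg.pow 2) 0
    _ ≤ 4 * ∫⁻ w in ball 0 1,
          ENNReal.ofReal (Real.exp (1 / 2)) * ‖weighted f (w + p)‖ₑ ^ 2 := by
        gcongr 4 * ?_
        exact setLIntegral_mono' measurableSet_ball hweight
    _ = 4 * ENNReal.ofReal (Real.exp (1 / 2)) * ∫⁻ w in ball p 1, ‖weighted f w‖ₑ ^ 2 := by
        rw [lintegral_const_mul' _ _ ENNReal.ofReal_ne_top, ← mul_assoc,
          setLIntegral_ball_comp_add_right fun w => ‖weighted f w‖ₑ ^ 2]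

theorem exists_pos_volume_norm_weighted_lt_le (ρ L : ℝ) {δ : ℝ≥0∞} (hδ : δ ≠ 0) :
    ∃ ε : ℝ, 0 < ε ∧ ∀ f : ℂ → ℂ, Differentiable ℂ f → ∀ p,
      (∀ w ∈ ball p ρ, ‖weighted f w‖ ≤ L * ‖weighted f p‖) →
      volume ({w | ‖weighted f w‖ < ε * ‖weighted f p‖} ∩ ball p ρ) ≤ δ := by
  set m := Real.exp (ρ ^ 2 / 4)
  have hm : 0 < m := Real.exp_pos _
  obtain ⟨ε, hε, h⟩ := exists_pos_volume_norm_lt_le ρ (m * L) hδ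
  refine ⟨ε / m, by positivity, fun f hf p hL => ?_⟩
  set g := weyl p f
  have hg0 : ‖g 0‖ = ‖weighted f p‖ := norm_weyl_zero p f
  have hbound : ∀ w ∈ ball (0 : ℂ) ρ, ‖g w‖ ≤ m * L * ‖g 0‖ := fun w hw => by
    refine (norm_weyl_le p f hw).trans ?_
    rw [hg0, mul_assoc]
    gcongr
    exact hL _ (by simpa using hw)
  refine le_trans ?_ (h g (differentiable_weyl p hf) 0 hbound)
  rw [← measure_preimage_add_right volume p]
  refine measure_mono fun w ⟨hlt, hball⟩ => ?_
  have hw : w ∈ ball (0 : ℂ) ρ := by simpa using hball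
  refine ⟨?_, hw⟩
  calc ‖g w‖ ≤ m * ‖weighted f (w + p)‖ := norm_weyl_le p f hw
    _ < m * (ε / m * ‖weighted f p‖) := by gcongr; exact hlt
    _ = ε * ‖g 0‖ := by rw [hg0]; field_simp

theorem norm_le_sqrt_toReal_mul_norm {x y : ℂ} {M : ℝ≥0∞} (hM : M ≠ ∞)
    (h : ‖x‖ₑ ^ 2 ≤ M * ‖y‖ₑ ^ 2) : ‖x‖ ≤ Real.sqrt M.toReal * ‖y‖ := by
  have hreal := ENNReal.toReal_mono (by finiteness) h
  simp only [ENNReal.toReal_mul, ENNReal.toReal_pow, toReal_enorm] at hreal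
  refine Real.le_sqrt_of_sq_le hreal |>.trans_eq ?_
  rw [Real.sqrt_mul ENNReal.toReal_nonneg, Real.sqrt_sq (norm_nonneg y)]

theorem setLIntegral_ball_enorm_sq_le {g : ℂ → ℂ} {y z : ℂ} {R : ℝ}
    (h : ∀ x ∈ ball z R, ‖g x‖ ≤ ‖y‖) :
    ∫⁻ x in ball z R, ‖g x‖ₑ ^ 2 ≤ volume (ball (0 : ℂ) R) * ‖y‖ₑ ^ 2 := by
  rw [mul_comm, ← Measure.addHaar_ball_center volume z, ← setLIntegral_const]
  refine setLIntegral_mono' measurableSet_ball fun x hx => ?_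
  gcongr
  exact enorm_le_iff_norm_le.mpr (h x hx)

theorem enorm_weighted_sq_le_of_doubling {f : ℂ → ℂ} (hf : Differentiable ℂ f) {z p : ℂ} {R : ℝ}
    {K : ℝ≥0∞} (hp : p ∈ closedBall z R) (hmax : ∀ x ∈ ball z R, ‖weighted f x‖ ≤ ‖weighted f p‖)
    (hdoubling : ∫⁻ x in ball z (3 * R + 1), ‖weighted f x‖ₑ ^ 2 ≤
      K * ∫⁻ x in ball z R, ‖weighted f x‖ₑ ^ 2) {w : ℂ} (hw : w ∈ ball p (2 * R)) :
    ‖weighted f w‖ₑ ^ 2 ≤ 4 * ENNReal.ofReal (Real.exp (1 / 2)) *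
      (K * volume (ball (0 : ℂ) R)) * ‖weighted f p‖ₑ ^ 2 := by
  have hsub : ball w 1 ⊆ ball z (3 * R + 1) := ball_subset_ball' (by
    linarith [dist_triangle w p z, mem_ball.mp hw, mem_closedBall.mp hp])
  calc ‖weighted f w‖ₑ ^ 2
      ≤ 4 * ENNReal.ofReal (Real.exp (1 / 2)) * ∫⁻ x in ball w 1, ‖weighted f x‖ₑ ^ 2 :=
        enorm_weighted_sq_le_setLIntegral hf w
    _ ≤ 4 * ENNReal.ofReal (Real.exp (1 / 2)) *
          (K * ∫⁻ x in ball z R, ‖weighted f x‖ₑ ^ 2) := by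
        gcongr
        exact (lintegral_mono_set hsub).trans hdoubling
    _ ≤ 4 * ENNReal.ofReal (Real.exp (1 / 2)) *
          (K * (volume (ball (0 : ℂ) R) * ‖weighted f p‖ₑ ^ 2)) := by
        gcongr
        exact setLIntegral_ball_enorm_sq_le hmax
    _ = _ := by ring

theorem norm_lt_mul_norm_of_enorm_sq_lt {x y : ℂ} {ε : ℝ} (hε : 0 ≤ ε)
    (h : ‖x‖ₑ ^ 2 < (ENNReal.ofReal ε * ‖y‖ₑ) ^ 2) : ‖x‖ < ε * ‖y‖ := by
  have hlt : ‖x‖ₑ < ENNReal.ofReal ε * ‖y‖ₑ := lt_of_pow_lt_pow_left' 2 h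
  rw [← ofReal_norm, ← ofReal_norm, ← ENNReal.ofReal_mul hε] at hlt
  exact (ENNReal.ofReal_lt_ofReal_iff_of_nonneg (norm_nonneg _)).mp hlt

theorem exists_mul_setLIntegral_le_of_doubling {R : ℝ} (hR : 0 < R) {K δ : ℝ≥0∞} (hK : K ≠ ∞)
    (hδ0 : δ ≠ 0) (hδ : δ ≠ ∞) :
    ∃ c : ℝ≥0∞, c ≠ 0 ∧ c ≠ ∞ ∧ ∀ f : ℂ → ℂ, Differentiable ℂ f → ∀ (z : ℂ) (G : Set ℂ),
      δ ≤ volume (G ∩ ball z R) →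
      ∫⁻ w in ball z (3 * R + 1), ‖weighted f w‖ₑ ^ 2 ≤
        K * ∫⁻ w in ball z R, ‖weighted f w‖ₑ ^ 2 →
      c * ∫⁻ w in ball z R, ‖weighted f w‖ₑ ^ 2 ≤ ∫⁻ w in G ∩ ball z R, ‖weighted f w‖ₑ ^ 2 := by
  set v := volume (ball (0 : ℂ) R)
  have hv : v ≠ ∞ := measure_ball_lt_top.ne
  have hv0 : v ≠ 0 := (measure_ball_pos _ _ hR).ne'
  set M := 4 * ENNReal.ofReal (Real.exp (1 / 2)) * (K * v)
  obtain ⟨ε, hε, hsmall⟩ := exists_pos_volume_norm_weighted_lt_le (2 * R) (Real.sqrt M.toReal)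
    (ENNReal.half_pos hδ0).ne'
  have hε0 : ENNReal.ofReal ε ≠ 0 := by simpa using hε
  refine ⟨ENNReal.ofReal ε ^ 2 * (δ / 2) * v⁻¹,
    mul_ne_zero (mul_ne_zero (pow_ne_zero 2 hε0) (ENNReal.half_pos hδ0).ne')
      (ENNReal.inv_ne_zero.mpr hv), by finiteness, fun f hf z G hG hdoubling => ?_⟩
  have hcont : Continuous (weighted f) := continuous_weighted hf.continuous
  obtain ⟨p, hp, hmax⟩ := (isCompact_closedBall z R).exists_isMaxOn
    (nonempty_closedBall.mpr hR.le) hcont.norm.continuousOn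
  replace hmax : ∀ x ∈ ball z R, ‖weighted f x‖ ≤ ‖weighted f p‖ :=
    fun x hx => hmax (ball_subset_closedBall hx)
  have hexceptional := hsmall f hf p fun w hw => norm_le_sqrt_toReal_mul_norm (by finiteness)
    (enorm_weighted_sq_le_of_doubling hf hp hmax hdoubling hw)
  have hball : ball z R ⊆ ball p (2 * R) := ball_subset_ball' (by
    linarith [mem_closedBall'.mp hp])
  have hlow : {w | ‖weighted f w‖ₑ ^ 2 < (ENNReal.ofReal ε * ‖weighted f p‖ₑ) ^ 2} ∩
      (G ∩ ball z R) ⊆ {w | ‖weighted f w‖ < ε * ‖weighted f p‖} ∩ ball p (2 * R) :=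
    fun w ⟨hw, _, hwz⟩ => ⟨norm_lt_mul_norm_of_enorm_sq_lt hε.le hw, hball hwz⟩
  calc ENNReal.ofReal ε ^ 2 * (δ / 2) * v⁻¹ * ∫⁻ w in ball z R, ‖weighted f w‖ₑ ^ 2
      ≤ ENNReal.ofReal ε ^ 2 * (δ / 2) * v⁻¹ * (v * ‖weighted f p‖ₑ ^ 2) := by
        gcongr
        exact setLIntegral_ball_enorm_sq_le hmax
    _ = (ENNReal.ofReal ε * ‖weighted f p‖ₑ) ^ 2 * (δ / 2) := by
        rw [mul_assoc, ENNReal.inv_mul_cancel_left hv0 hv]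
        ring
    _ ≤ ∫⁻ w in G ∩ ball z R, ‖weighted f w‖ₑ ^ 2 :=
        mul_half_le_setLIntegral_of_measure_lt_le (hcont.enorm.measurable.pow_const 2) hδ hG
          ((measure_mono hlow).trans hexceptional)

theorem areaMeasure_le_volume : areaMeasure ≤ volume := by
  refine Measure.le_iff.mpr fun s _ => ?_
  rw [areaMeasure, Measure.smul_apply, smul_eq_mul]
  exact mul_le_of_le_one_left' (by
    rw [ENNReal.ofReal_le_one]
    exact inv_le_one_of_one_le₀ (by linarith [Real.two_le_pi]))

theorem lintegral_areaMeasure (u : ℂ → ℝ≥0∞) :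
    ∫⁻ w, u w ∂areaMeasure = ENNReal.ofReal Real.pi⁻¹ * ∫⁻ w, u w := by
  rw [areaMeasure, lintegral_smul_measure, smul_eq_mul]

theorem setLIntegral_areaMeasure (G : Set ℂ) (u : ℂ → ℝ≥0∞) :
    ∫⁻ w in G, u w ∂areaMeasure = ENNReal.ofReal Real.pi⁻¹ * ∫⁻ w in G, u w := by
  rw [areaMeasure, Measure.restrict_smul, lintegral_smul_measure, smul_eq_mul]

theorem lintegral_gaussianMeasure (u : ℂ → ℝ≥0∞) :
    ∫⁻ w, u w ∂gaussianMeasure =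
      2⁻¹ * ∫⁻ w, u w * ENNReal.ofReal (Real.exp (-‖w‖ ^ 2 / 2)) ∂areaMeasure := by
  rw [gaussianMeasure, lintegral_withDensity_eq_lintegral_mul_non_measurable _ (by fun_prop)
    (Eventually.of_forall fun _ => ENNReal.ofReal_lt_top),
    ← lintegral_const_mul' _ _ (by simp)]
  refine lintegral_congr fun w => ?_
  rw [Pi.mul_apply, ENNReal.ofReal_mul (by norm_num), one_div,
    ENNReal.ofReal_inv_of_pos (by norm_num), ENNReal.ofReal_ofNat]
  ring

theorem lintegral_enorm_sq_gaussianMeasure (f : ℂ → ℂ) :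
    ∫⁻ w, ‖f w‖ₑ ^ 2 ∂gaussianMeasure = 2⁻¹ * ∫⁻ w, ‖weighted f w‖ₑ ^ 2 ∂areaMeasure := by
  simp only [lintegral_gaussianMeasure, enorm_weighted_sq]

theorem lintegral_enorm_weighted_sq_ne_top {f : ℂ → ℂ} (hf : MemLp f 2 gaussianMeasure) :
    ∫⁻ w, ‖weighted f w‖ₑ ^ 2 ≠ ∞ := by
  have h := ENNReal.pow_lt_top (n := 2) hf.2
  rw [eLpNorm_two_sq, lintegral_enorm_sq_gaussianMeasure, lintegral_areaMeasure] at h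
  refine fun htop => h.ne ?_
  rw [htop, ENNReal.mul_top (by simp [Real.pi_pos]), ENNReal.mul_top (by simp)]

theorem isReverseCarleson_iff {μ : Measure ℂ} :
    IsReverseCarleson μ ↔ ∃ C : ℝ≥0∞, C ≠ 0 ∧ ∀ f : ℂ → ℂ, Differentiable ℂ f →
      MemLp f 2 gaussianMeasure →
        C * ∫⁻ w, ‖weighted f w‖ₑ ^ 2 ∂areaMeasure ≤ ∫⁻ w, ‖weighted f w‖ₑ ^ 2 ∂μ := by
  simp only [IsReverseCarleson, ← enorm_weighted_sq]
  constructor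
  · rintro ⟨C, hC, h⟩
    exact ⟨ENNReal.ofReal C, by simpa using hC, h⟩
  · rintro ⟨C, hC, h⟩
    refine ⟨(min C 1).toReal, ENNReal.toReal_pos (by simp [hC]) (by simp), fun f hf hf2 => ?_⟩
    rw [ENNReal.ofReal_toReal (by simp)]
    refine le_trans ?_ (h f hf hf2)
    gcongr
    exact min_le_left _ _

theorem isReverseCarleson_restrict_of_le_areaMeasure_inter_ball {G : Set ℂ} {R : ℝ} (hR : 0 < R)
    {δ : ℝ≥0∞} (hδ : δ ≠ 0) (hG : ∀ z, δ ≤ areaMeasure (G ∩ ball z R)) :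
    IsReverseCarleson (areaMeasure.restrict G) := by
  have hG' : ∀ z, δ ≤ volume (G ∩ ball z R) := fun z => (hG z).trans (areaMeasure_le_volume _)
  have hδ_top : δ ≠ ∞ := ne_top_of_le_ne_top measure_ball_lt_top.ne
    ((hG' 0).trans (measure_mono inter_subset_right))
  set v := volume (ball (0 : ℂ) R)
  set V := volume (ball (0 : ℂ) (3 * R + 1))
  have hv : v ≠ ∞ := measure_ball_lt_top.ne
  have hv0 : v ≠ 0 := (measure_ball_pos _ _ hR).ne'
  have hV : V ≠ ∞ := measure_ball_lt_top.ne
  obtain ⟨c, hc0, hc, hlocal⟩ := exists_mul_setLIntegral_le_of_doubling hR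
    (K := v⁻¹ * (2 * V)) (by finiteness) hδ hδ_top
  refine isReverseCarleson_iff.mpr ⟨c / 2, (ENNReal.half_pos hc0).ne', fun f hf hf2 => ?_⟩
  have hmeas : Measurable fun w => ‖weighted f w‖ₑ ^ 2 :=
    (continuous_weighted hf.continuous).enorm.measurable.pow_const 2
  have hdom : c * ∫⁻ w, ‖weighted f w‖ₑ ^ 2 ≤ 2 * ∫⁻ w in G, ‖weighted f w‖ₑ ^ 2 := by
    refine mul_lintegral_le_two_mul_setLIntegral_of_doubling hmeas
      (lintegral_enorm_weighted_sq_ne_top hf2) hR (R' := 3 * R + 1) (by positivity) hc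
      fun z hz => hlocal f hf z G (hG' z) ?_
    rwa [mul_assoc, ← ENNReal.mul_le_iff_le_inv hv0 hv]
  rw [lintegral_areaMeasure, setLIntegral_areaMeasure, mul_left_comm]
  gcongr
  rw [← ENNReal.mul_div_right_comm]
  exact ENNReal.div_le_of_le_mul' hdom

section RotationInvariant

variable {E : Type*} [NormedAddCommGroup E] {μ : Measure ℂ} [SFinite μ] {h : ℂ → E}

theorem integrable_uncurry_comp_circleMap_mul
    (hμ : ∀ c : ℂ, ‖c‖ = 1 → MeasurePreserving (fun w => c * w) μ μ) (hc : Continuous h)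
    (hi : Integrable h μ) :
    Integrable (Function.uncurry fun w t => h (circleMap 0 1 t * w))
      (μ.prod (volume.restrict (uIoc 0 (2 * Real.pi)))) := by
  have hunit : ∀ t : ℝ, ‖circleMap 0 1 t‖ = 1 := fun t => by simp
  have hcont : Continuous (Function.uncurry fun w t => h (circleMap 0 1 t * w)) := by
    unfold Function.uncurry circleMap
    fun_prop
  have hnorm : ∀ t, ∫ w, ‖h (circleMap 0 1 t * w)‖ ∂μ = ∫ w, ‖h w‖ ∂μ := fun t =>
    (hμ _ (hunit t)).integral_comp (measurableEmbedding_mulLeft₀ (by simp)) fun w => ‖h w‖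
  rw [integrable_prod_iff' hcont.aestronglyMeasurable]
  refine ⟨Eventually.of_forall fun t => (hμ _ (hunit t)).integrable_comp_of_integrable hi, ?_⟩
  simp only [Function.uncurry_apply_pair, hnorm]
  exact intervalIntegrable_const.def'

theorem integral_eq_measureReal_univ_smul_apply_zero [NormedSpace ℂ E] [CompleteSpace E]
    (hμ : ∀ c : ℂ, ‖c‖ = 1 → MeasurePreserving (fun w => c * w) μ μ) (hd : Differentiable ℂ h)
    (hi : Integrable h μ) : ∫ w, h w ∂μ = μ.real univ • h 0 := by
  have hrot : ∀ t, ∫ w, h (circleMap 0 1 t * w) ∂μ = ∫ w, h w ∂μ := fun t =>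
    (hμ _ (by simp)).integral_comp (measurableEmbedding_mulLeft₀ (by simp)) h
  have hmean : ∀ w, Real.circleAverage (fun ζ => h (ζ * w)) 0 1 = h 0 := fun w => by
    have hdiff : Differentiable ℂ fun ζ => h (ζ * w) := by fun_prop
    simpa using hdiff.diffContOnCl.circleAverage (c := 0) (R := 1)
  have hpi : (2 * Real.pi)⁻¹ * (2 * Real.pi - 0) = 1 := by
    rw [sub_zero, inv_mul_cancel₀ (by positivity)]
  calc ∫ w, h w ∂μ = (2 * Real.pi)⁻¹ • ∫ t in 0..2 * Real.pi, ∫ w, h (circleMap 0 1 t * w) ∂μ := by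
        simp only [hrot, intervalIntegral.integral_const, smul_smul, hpi, one_smul]
    _ = ∫ w, Real.circleAverage (fun ζ => h (ζ * w)) 0 1 ∂μ := by
        rw [intervalIntegral_integral_swap, ← integral_smul]
        · rfl
        exact (integrable_uncurry_comp_circleMap_mul hμ hd.continuous hi).swap
    _ = μ.real univ • h 0 := by simp only [hmean, integral_const]

end RotationInvariant

instance isAddHaarMeasure_areaMeasure : areaMeasure.IsAddHaarMeasure :=
  Measure.IsAddHaarMeasure.smul _ (by simp [Real.pi_pos]) (by simp)

theorem measurePreserving_mul_areaMeasure {c : ℂ} (hc : ‖c‖ = 1) :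
    MeasurePreserving (fun w => c * w) areaMeasure areaMeasure := by
  have h : MeasurePreserving (rotation ⟨c, mem_sphere_zero_iff_norm.mpr hc⟩) volume volume :=
    LinearIsometryEquiv.measurePreserving _
  exact h.smul_measure _

theorem measurePreserving_mul_gaussianMeasure {c : ℂ} (hc : ‖c‖ = 1) :
    MeasurePreserving (fun w => c * w) gaussianMeasure gaussianMeasure := by
  have hm := measurePreserving_mul_areaMeasure hc
  refine ⟨hm.measurable, Measure.ext fun s hs => ?_⟩
  rw [Measure.map_apply hm.measurable hs, gaussianMeasure,
    withDensity_apply _ (hm.measurable hs), withDensity_apply _ hs,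
    ← hm.setLIntegral_comp_preimage hs (by fun_prop)]
  simp only [norm_mul, hc, one_mul]

theorem lintegral_exp_areaMeasure :
    ∫⁻ w, ENNReal.ofReal (Real.exp (-‖w‖ ^ 2 / 2)) ∂areaMeasure = 2 := by
  have heq : (fun w : ℂ => Real.exp (-‖w‖ ^ 2 / 2)) = fun w => Real.exp (-(1 / 2) * ‖w‖ ^ 2) := by
    ext w
    ring_nf
  have hint : ∫ w : ℂ, Real.exp (-‖w‖ ^ 2 / 2) = 2 * Real.pi := by
    rw [heq, GaussianFourier.integral_rexp_neg_mul_sq_norm (by norm_num),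
      Complex.finrank_real_complex]
    norm_num
    ring
  have hi : Integrable fun w : ℂ => Real.exp (-‖w‖ ^ 2 / 2) :=
    Integrable.of_integral_ne_zero (by rw [hint]; positivity)
  rw [lintegral_areaMeasure, ← ofReal_integral_eq_lintegral_ofReal hi
    (Eventually.of_forall fun w => (Real.exp_pos _).le), hint,
    ← ENNReal.ofReal_mul (by positivity), mul_comm 2, inv_mul_cancel_left₀ Real.pi_pos.ne',
    ENNReal.ofReal_ofNat]

theorem gaussianMeasure_apply {A : Set ℂ} (hA : MeasurableSet A) :
    gaussianMeasure A =
      2⁻¹ * ∫⁻ w in A, ENNReal.ofReal (Real.exp (-‖w‖ ^ 2 / 2)) ∂areaMeasure := by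
  rw [← lintegral_indicator_one hA, lintegral_gaussianMeasure, ← lintegral_indicator hA]
  simp only [indicator, Pi.one_apply, ite_mul, one_mul, zero_mul]

instance isProbabilityMeasure_gaussianMeasure : IsProbabilityMeasure gaussianMeasure := ⟨by
  rw [gaussianMeasure_apply MeasurableSet.univ, Measure.restrict_univ, lintegral_exp_areaMeasure,
    ENNReal.inv_mul_cancel two_ne_zero ENNReal.ofNat_ne_top]⟩

theorem integral_gaussianMeasure_eq_apply_zero {h : ℂ → ℂ} (hd : Differentiable ℂ h)
    (hi : Integrable h gaussianMeasure) : ∫ w, h w ∂gaussianMeasure = h 0 := by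
  rw [integral_eq_measureReal_univ_smul_apply_zero
    (fun _ => measurePreserving_mul_gaussianMeasure) hd hi, probReal_univ, one_smul]

theorem lintegral_enorm_sq_weyl (z : ℂ) (f : ℂ → ℂ) :
    ∫⁻ w, ‖weyl z f w‖ₑ ^ 2 ∂gaussianMeasure = ∫⁻ w, ‖f w‖ₑ ^ 2 ∂gaussianMeasure := by
  have h : ∀ w, ‖weighted (weyl z f) w‖ₑ = ‖weighted f (w + z)‖ₑ := fun w => by
    rw [← ofReal_norm, norm_weighted_weyl, ofReal_norm]
  simp only [lintegral_enorm_sq_gaussianMeasure, h]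
  rw [lintegral_add_right_eq_self fun w => ‖weighted f w‖ₑ ^ 2]

theorem memLp_weyl (z : ℂ) {f : ℂ → ℂ} (hf : Continuous f) (h : MemLp f 2 gaussianMeasure) :
    MemLp (weyl z f) 2 gaussianMeasure := by
  refine ⟨Continuous.aestronglyMeasurable (by unfold weyl; fun_prop), ?_⟩
  have hlt := ENNReal.pow_lt_top (n := 2) h.2
  rw [eLpNorm_two_sq, ← lintegral_enorm_sq_weyl z, ← eLpNorm_two_sq] at hlt
  simpa using hlt

theorem normalizedKernel_eq_weyl (z : ℂ) : normalizedKernel z = weyl (-z) 1 := by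
  ext w
  simp only [normalizedKernel, weyl, Pi.one_apply, map_neg, norm_neg]
  ring_nf

theorem differentiable_normalizedKernel (z : ℂ) : Differentiable ℂ (normalizedKernel z) := by
  rw [normalizedKernel_eq_weyl]
  exact differentiable_weyl _ (differentiable_const 1)

theorem memLp_normalizedKernel (z : ℂ) : MemLp (normalizedKernel z) 2 gaussianMeasure := by
  rw [normalizedKernel_eq_weyl]
  exact memLp_weyl _ continuous_const (memLp_const 1)

theorem enorm_weighted_normalizedKernel_sq (z w : ℂ) :
    ‖weighted (normalizedKernel z) w‖ₑ ^ 2 =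
      ENNReal.ofReal (Real.exp (-‖w - z‖ ^ 2 / 2)) := by
  rw [← ofReal_norm, normalizedKernel_eq_weyl, norm_weighted_weyl, ofReal_norm,
    enorm_weighted_sq, Pi.one_apply, enorm_one, one_pow, one_mul, ← sub_eq_add_neg]

theorem setLIntegral_enorm_weighted_normalizedKernel_sq (z : ℂ) {A : Set ℂ}
    (hA : MeasurableSet A) :
    ∫⁻ w in A, ‖weighted (normalizedKernel z) w‖ₑ ^ 2 ∂areaMeasure =
      2 * gaussianMeasure ((· + z) ⁻¹' A) := by
  have hpre : MeasurableSet ((· + z) ⁻¹' A) := measurable_add_const z hA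
  have hshift := (measurePreserving_add_right areaMeasure z).setLIntegral_comp_preimage_emb
    (measurableEmbedding_addRight z) (fun w => ENNReal.ofReal (Real.exp (-‖w - z‖ ^ 2 / 2))) A
  simp only [add_sub_cancel_right] at hshift
  rw [gaussianMeasure_apply hpre, ENNReal.mul_inv_cancel_left two_ne_zero ENNReal.ofNat_ne_top,
    hshift]
  simp only [enorm_weighted_normalizedKernel_sq]

theorem lintegral_enorm_weighted_normalizedKernel_sq (z : ℂ) :
    ∫⁻ w, ‖weighted (normalizedKernel z) w‖ₑ ^ 2 ∂areaMeasure = 2 := by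
  have h := setLIntegral_enorm_weighted_normalizedKernel_sq z MeasurableSet.univ
  rwa [Measure.restrict_univ, preimage_univ, measure_univ, mul_one] at h

theorem exists_setLIntegral_compl_ball_normalizedKernel_le {δ : ℝ≥0∞} (hδ : δ ≠ 0) :
    ∃ R : ℝ, 0 < R ∧ ∀ z,
      ∫⁻ w in (ball z R)ᶜ, ‖weighted (normalizedKernel z) w‖ₑ ^ 2 ∂areaMeasure ≤ δ := by
  obtain ⟨K, hK, hle⟩ := isTightMeasureSet_iff_exists_isCompact_measure_compl_le.mp
    (isTightMeasureSet_singleton (μ := gaussianMeasure)) (δ / 2)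
    (ENNReal.half_pos hδ)
  obtain ⟨R, hR, hKR⟩ := hK.isBounded.subset_ball_lt 0 0
  refine ⟨R, hR, fun z => ?_⟩
  have hpre : (· + z) ⁻¹' (ball z R)ᶜ = (ball (0 : ℂ) R)ᶜ := by
    ext w
    simp
  calc ∫⁻ w in (ball z R)ᶜ, ‖weighted (normalizedKernel z) w‖ₑ ^ 2 ∂areaMeasure
      = 2 * gaussianMeasure (ball 0 R)ᶜ := by
        rw [setLIntegral_enorm_weighted_normalizedKernel_sq z measurableSet_ball.compl, hpre]
    _ ≤ 2 * (δ / 2) := by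
        gcongr
        exact (measure_mono (compl_subset_compl.mpr hKR)).trans (hle _ rfl)
    _ = δ := ENNReal.mul_div_cancel two_ne_zero ENNReal.ofNat_ne_top

theorem memLp_kernel (z : ℂ) : MemLp (kernel z) 2 gaussianMeasure := by
  have h : kernel z = fun w => Complex.exp ((‖z‖ : ℂ) ^ 2 / 4) * normalizedKernel z w := by
    ext w
    rw [kernel, normalizedKernel, ← Complex.exp_add]
    ring_nf
  rw [h]
  exact (memLp_normalizedKernel z).const_mul _

theorem integral_gaussianMeasure (g : ℂ → ℂ) :
    ∫ w, g w ∂gaussianMeasure =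
      (1 / 2) * ∫ w, g w * (Real.exp (-‖w‖ ^ 2 / 2) : ℂ) ∂areaMeasure := by
  rw [gaussianMeasure, integral_withDensity_eq_integral_toReal_smul (by fun_prop)
    (Eventually.of_forall fun _ => ENNReal.ofReal_lt_top), ← integral_const_mul]
  congr with w
  rw [ENNReal.toReal_ofReal (by positivity), Complex.real_smul]
  push_cast
  ring

theorem weyl_mul_exp (z : ℂ) (f : ℂ → ℂ) (w : ℂ) :
    weyl z f w * (Real.exp (-‖w‖ ^ 2 / 2) : ℂ) = Complex.exp (-(‖z‖ : ℂ) ^ 2 / 4) *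
      (f (w + z) * conj (kernel z (w + z)) * (Real.exp (-‖w + z‖ ^ 2 / 2) : ℂ)) := by
  have hexp : Complex.exp (-(conj z * w) / 2 - (‖z‖ : ℂ) ^ 2 / 4) *
      (Real.exp (-‖w‖ ^ 2 / 2) : ℂ) =
      Complex.exp (-(‖z‖ : ℂ) ^ 2 / 4) *
        (conj (kernel z (w + z)) * (Real.exp (-‖w + z‖ ^ 2 / 2) : ℂ)) := by
    rw [kernel, ← Complex.exp_conj]
    push_cast
    simp only [← Complex.exp_add, ← Complex.mul_conj', map_add, map_mul, map_div₀,
      Complex.conj_conj, map_ofNat]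
    ring_nf
  rw [weyl]
  linear_combination f (w + z) * hexp

theorem integral_mul_conj_kernel {f : ℂ → ℂ} (hf : Differentiable ℂ f)
    (hL : MemLp f 2 gaussianMeasure) (z : ℂ) :
    ∫ w, f w * conj (kernel z w) ∂gaussianMeasure = f z := by
  have hmean := integral_gaussianMeasure_eq_apply_zero (differentiable_weyl z hf)
    ((memLp_weyl z hf.continuous hL).integrable (by norm_num))
  have hzero : weyl z f 0 = Complex.exp (-(‖z‖ : ℂ) ^ 2 / 4) * f z := by
    simp only [weyl, zero_add, mul_zero, neg_zero, zero_div, zero_sub]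
    rw [mul_comm, neg_div]
  rw [hzero, integral_gaussianMeasure] at hmean
  simp only [weyl_mul_exp] at hmean
  rw [integral_const_mul, integral_add_right_eq_self
      (fun w => f w * conj (kernel z w) * (Real.exp (-‖w‖ ^ 2 / 2) : ℂ)),
    mul_left_comm, ← integral_gaussianMeasure] at hmean
  exact mul_left_cancel₀ (Complex.exp_ne_zero _) hmean

theorem differentiable_kernel (z : ℂ) : Differentiable ℂ (kernel z) := by
  unfold kernel
  fun_prop

/-- An entire function in `L²(ℂ, dλ)` as an element of the Fock space. -/
def ofEntire (f : ℂ → ℂ) (hf : Differentiable ℂ f) (hL : MemLp f 2 gaussianMeasure) : fockSpace :=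
  ⟨hL.toLp f, f, hf, hL.coeFn_toLp⟩

theorem entireRep_ofEntire {f : ℂ → ℂ} (hf : Differentiable ℂ f) (hL : MemLp f 2 gaussianMeasure) :
    entireRep (ofEntire f hf hL) = f :=
  ((differentiable_entireRep _).continuous.ae_eq_iff_eq gaussianMeasure hf.continuous).mp
    ((coeFn_eq_entireRep _).symm.trans hL.coeFn_toLp)

theorem memLp_entireRep (f : fockSpace) : MemLp (entireRep f) 2 gaussianMeasure :=
  (memLp_congr_ae (coeFn_eq_entireRep f)).mp (Lp.memLp _)

theorem inner_eq_integral_entireRep (f g : fockSpace) :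
    inner ℂ g f = ∫ w, entireRep f w * conj (entireRep g w) ∂gaussianMeasure := by
  rw [Submodule.coe_inner, L2.inner_def]
  refine integral_congr_ae ?_
  filter_upwards [coeFn_eq_entireRep f, coeFn_eq_entireRep g] with w hf hg
  rw [hf, hg, RCLike.inner_apply]

theorem enorm_sq_eq_lintegral_weighted (f : fockSpace) :
    ‖f‖ₑ ^ 2 = 2⁻¹ * ∫⁻ w, ‖weighted (entireRep f) w‖ₑ ^ 2 ∂areaMeasure := by
  rw [← lintegral_enorm_sq_gaussianMeasure, ← eLpNorm_two_sq,
    ← eLpNorm_congr_ae (coeFn_eq_entireRep f), ← Lp.enorm_def]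
  rfl

section Toeplitz

variable {φ : ℂ → ℂ} (hφ : MemLp φ ∞ areaMeasure) (f : fockSpace)

theorem coeFn_holderL_toLp :
    ⇑((ContinuousLinearMap.mul ℂ ℂ).holderL gaussianMeasure ∞ 2 2
      ((memLp_top_gaussian hφ).toLp φ) (f : Lp ℂ 2 gaussianMeasure)) =ᵐ[gaussianMeasure]
      fun w => φ w * entireRep f w := by
  refine (ContinuousLinearMap.coeFn_holder (ContinuousLinearMap.mul ℂ ℂ) _ _).trans ?_
  filter_upwards [(memLp_top_gaussian hφ).coeFn_toLp, coeFn_eq_entireRep f] with w hφw hfw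
  rw [hφw, hfw, ContinuousLinearMap.mul_apply']

theorem inner_toeplitz (g : fockSpace) :
    inner ℂ g (toeplitz φ hφ f) =
      ∫ w, φ w * entireRep f w * conj (entireRep g w) ∂gaussianMeasure := by
  rw [toeplitz]
  simp only [ContinuousLinearMap.comp_apply, Submodule.subtypeL_apply]
  rw [Submodule.inner_orthogonalProjectionOnto_eq_of_mem_left, L2.inner_def]
  refine integral_congr_ae ?_
  filter_upwards [coeFn_holderL_toLp hφ f, coeFn_eq_entireRep g] with w hfw hgw
  rw [hfw, hgw, RCLike.inner_apply]

theorem entireRep_toeplitz_apply (z : ℂ) :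
    entireRep (toeplitz φ hφ f) z =
      ∫ w, φ w * entireRep f w * conj (kernel z w) ∂gaussianMeasure := by
  have h := inner_toeplitz hφ f (ofEntire (kernel z) (differentiable_kernel z) (memLp_kernel z))
  rw [inner_eq_integral_entireRep, entireRep_ofEntire] at h
  rw [← h, integral_mul_conj_kernel (differentiable_entireRep _) (memLp_entireRep _)]

theorem enorm_toeplitz_sq_le :
    ‖toeplitz φ hφ f‖ₑ ^ 2 ≤ ∫⁻ w, ‖φ w‖ₑ ^ 2 * ‖entireRep f w‖ₑ ^ 2 ∂gaussianMeasure := by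
  set u := (ContinuousLinearMap.mul ℂ ℂ).holderL gaussianMeasure ∞ 2 2
    ((memLp_top_gaussian hφ).toLp φ) (f : Lp ℂ 2 gaussianMeasure)
  have hproj : ‖toeplitz φ hφ f‖ₑ ≤ ‖u‖ₑ :=
    enorm_le_iff_norm_le.mpr (fockSpace.norm_orthogonalProjectionOnto_apply_le u)
  calc ‖toeplitz φ hφ f‖ₑ ^ 2 ≤ ‖u‖ₑ ^ 2 := by gcongr
    _ = ∫⁻ w, ‖φ w‖ₑ ^ 2 * ‖entireRep f w‖ₑ ^ 2 ∂gaussianMeasure := by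
        rw [Lp.enorm_def, eLpNorm_congr_ae (coeFn_holderL_toLp hφ f), eLpNorm_two_sq]
        simp only [enorm_mul, mul_pow]

end Toeplitz

/-- The measure `dμ = φ dA` with density the nonnegative part of the symbol `φ`. -/
abbrev symbolMeasure (φ : ℂ → ℝ) : Measure ℂ :=
  areaMeasure.withDensity fun z => ENNReal.ofReal (φ z)

section Symbol

variable {φ : ℂ → ℝ}

theorem symbolMeasure_le_smul (φ : ℂ → ℝ) :
    symbolMeasure φ ≤ eLpNorm φ ∞ areaMeasure • areaMeasure := by
  rw [← withDensity_const]
  refine withDensity_mono ?_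
  filter_upwards [enorm_ae_le_eLpNormEssSup φ areaMeasure] with z hz
  exact (Real.ofReal_le_enorm _).trans hz

theorem smul_restrict_le_symbolMeasure (hφ : AEMeasurable φ areaMeasure) (r : ℝ) :
    ENNReal.ofReal r • areaMeasure.restrict {z | r < φ z} ≤ symbolMeasure φ := by
  refine Measure.le_iff.mpr fun s hs => ?_
  rw [Measure.smul_apply, smul_eq_mul, Measure.restrict_apply hs, inter_comm,
    ← Measure.restrict_apply' hs, withDensity_apply _ hs]
  calc ENNReal.ofReal r * areaMeasure.restrict s {z | r < φ z}
      ≤ ENNReal.ofReal r *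
          areaMeasure.restrict s {z | ENNReal.ofReal r ≤ ENNReal.ofReal (φ z)} := by
        gcongr with z
        exact fun hz => ENNReal.ofReal_le_ofReal (le_of_lt hz)
    _ ≤ ∫⁻ z in s, ENNReal.ofReal (φ z) ∂areaMeasure :=
        mul_meas_ge_le_lintegral₀ hφ.ennreal_ofReal.restrict _

theorem lintegral_weighted_symbolMeasure (hφ : AEMeasurable φ areaMeasure) {f : ℂ → ℂ}
    (hf : Continuous f) :
    2⁻¹ * ∫⁻ w, ‖weighted f w‖ₑ ^ 2 ∂symbolMeasure φ =
      ∫⁻ w, ENNReal.ofReal (φ w) * ‖f w‖ₑ ^ 2 ∂gaussianMeasure := by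
  have hm : Measurable fun w => ‖weighted f w‖ₑ ^ 2 := by
    have := continuous_weighted hf
    fun_prop
  rw [lintegral_gaussianMeasure,
    lintegral_withDensity_eq_lintegral_mul₀ hφ.ennreal_ofReal hm.aemeasurable]
  simp only [Pi.mul_apply, enorm_weighted_sq, mul_assoc]

theorem integrable_mul_conj_kernel (f : fockSpace) (z : ℂ) :
    Integrable (fun w => entireRep f w * conj (kernel z w)) gaussianMeasure :=
  (memLp_entireRep f).integrable_mul (memLp_kernel z).star

theorem integrable_toeplitzIntegrand (hφ : MemLp φ ∞ areaMeasure)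
    (hφ0 : ∀ᵐ z ∂areaMeasure, 0 ≤ φ z) (f : fockSpace) (z : ℂ) :
    Integrable (toeplitzIntegrand (entireRep f) z) (symbolMeasure φ) := by
  rw [integrable_withDensity_iff_integrable_smul₀' hφ.1.aemeasurable.ennreal_ofReal
    (Eventually.of_forall fun _ => ENNReal.ofReal_lt_top)]
  have h := (integrable_mul_conj_kernel f z).smul_of_top_right
    (memLp_top_gaussian (φ := fun w => (φ w : ℂ)) hφ.ofReal)
  rw [gaussianMeasure, integrable_withDensity_iff_integrable_smul' (by fun_prop)
    (Eventually.of_forall fun _ => ENNReal.ofReal_lt_top)] at h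
  refine (h.const_mul 2).congr ?_
  filter_upwards [hφ0] with w hw
  rw [ENNReal.toReal_ofReal hw, ENNReal.toReal_ofReal (by positivity), toeplitzIntegrand]
  simp only [Complex.real_smul, Pi.smul_apply', smul_eq_mul]
  push_cast
  ring

theorem entireRep_toeplitz_eq_toeplitzMeasure (hφ : MemLp φ ∞ areaMeasure)
    (hφ0 : ∀ᵐ z ∂areaMeasure, 0 ≤ φ z) (f : fockSpace) (z : ℂ) :
    entireRep (toeplitz (fun z => (φ z : ℂ)) hφ.ofReal f) z =
      toeplitzMeasure (symbolMeasure φ) (entireRep f) z := by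
  rw [entireRep_toeplitz_apply, toeplitzMeasure, integral_gaussianMeasure,
    integral_withDensity_eq_integral_toReal_smul₀ hφ.1.aemeasurable.ennreal_ofReal
    (Eventually.of_forall fun _ => ENNReal.ofReal_lt_top)]
  congr 1
  refine integral_congr_ae ?_
  filter_upwards [hφ0] with w hw
  rw [ENNReal.toReal_ofReal hw, toeplitzIntegrand, Complex.real_smul]
  ring

theorem ofReal_integral_symbol_mul (hφ : MemLp φ ∞ areaMeasure)
    (hφ0 : ∀ᵐ z ∂areaMeasure, 0 ≤ φ z) {f : ℂ → ℂ} (hf : Continuous f)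
    (hL : MemLp f 2 gaussianMeasure) :
    ENNReal.ofReal (∫ w, φ w * ‖f w‖ ^ 2 ∂gaussianMeasure) =
      2⁻¹ * ∫⁻ w, ‖weighted f w‖ₑ ^ 2 ∂symbolMeasure φ := by
  have hφ' : MemLp φ ∞ gaussianMeasure :=
    (memLp_top_gaussian (φ := fun w => (φ w : ℂ)) hφ.ofReal).re
  have hi : Integrable (fun w => φ w * ‖f w‖ ^ 2) gaussianMeasure :=
    Integrable.smul_of_top_right (φ := φ) hL.integrable_norm_pow' hφ'
  have h0 := gaussianMeasure_absolutelyContinuous.ae_le hφ0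
  rw [lintegral_weighted_symbolMeasure hφ.1.aemeasurable hf, ofReal_integral_eq_lintegral_ofReal hi]
  · refine lintegral_congr_ae ?_
    filter_upwards [h0] with w hw
    rw [ENNReal.ofReal_mul hw, ENNReal.ofReal_pow (norm_nonneg _), ofReal_norm]
  · filter_upwards [h0] with w hw
    exact mul_nonneg hw (by positivity)

theorem berezinMeasure_eq_lintegral_weighted (μ : Measure ℂ) (z : ℂ) :
    berezinMeasure μ z = 2⁻¹ * ∫⁻ w, ‖weighted (normalizedKernel z) w‖ₑ ^ 2 ∂μ := by
  simp only [berezinMeasure, one_div, enorm_weighted_sq]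

theorem berezinMeasure_symbolMeasure (hφ : MemLp φ ∞ areaMeasure)
    (hφ0 : ∀ᵐ z ∂areaMeasure, 0 ≤ φ z) (z : ℂ) :
    berezinMeasure (symbolMeasure φ) z = ENNReal.ofReal (berezin φ z) := by
  rw [berezin, ofReal_integral_symbol_mul hφ hφ0 (differentiable_normalizedKernel z).continuous
    (memLp_normalizedKernel z), berezinMeasure_eq_lintegral_weighted]

theorem inner_toeplitz_self (hφ : MemLp φ ∞ areaMeasure) (f : fockSpace) :
    inner ℂ f (toeplitz (fun z => (φ z : ℂ)) hφ.ofReal f) =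
      ((∫ w, φ w * ‖entireRep f w‖ ^ 2 ∂gaussianMeasure : ℝ) : ℂ) := by
  rw [inner_toeplitz, ← integral_complex_ofReal]
  congr with w
  rw [mul_assoc, Complex.mul_conj']
  push_cast
  rfl

theorem enorm_toeplitz_sq_le_symbolMeasure (hφ : MemLp φ ∞ areaMeasure)
    (hφ0 : ∀ᵐ z ∂areaMeasure, 0 ≤ φ z) (f : fockSpace) :
    ‖toeplitz (fun z => (φ z : ℂ)) hφ.ofReal f‖ₑ ^ 2 ≤ eLpNorm φ ∞ areaMeasure *
      (2⁻¹ * ∫⁻ w, ‖weighted (entireRep f) w‖ₑ ^ 2 ∂symbolMeasure φ) := by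
  refine (enorm_toeplitz_sq_le (φ := fun w => (φ w : ℂ)) hφ.ofReal f).trans ?_
  rw [lintegral_weighted_symbolMeasure hφ.1.aemeasurable (differentiable_entireRep f).continuous,
    ← lintegral_const_mul' _ _ hφ.2.ne]
  refine lintegral_mono_ae ?_
  filter_upwards [gaussianMeasure_absolutelyContinuous.ae_le hφ0,
    gaussianMeasure_absolutelyContinuous.ae_le (enorm_ae_le_eLpNormEssSup φ areaMeasure)]
    with w hw hle
  have hcast : ‖(φ w : ℂ)‖ₑ = ‖φ w‖ₑ := by rw [← ofReal_norm, Complex.norm_real, ofReal_norm]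
  rw [hcast, sq, mul_assoc, ← Real.enorm_eq_ofReal hw]
  gcongr
  exact hle

end Symbol

theorem two_mul_berezinMeasure_le (μ : Measure ℂ) (z : ℂ) (r : ℝ) :
    2 * berezinMeasure μ z ≤ μ (ball z r) +
      ∫⁻ w in (ball z r)ᶜ, ‖weighted (normalizedKernel z) w‖ₑ ^ 2 ∂μ := by
  rw [berezinMeasure_eq_lintegral_weighted,
    ENNReal.mul_inv_cancel_left two_ne_zero ENNReal.ofNat_ne_top,
    ← lintegral_add_compl _ (measurableSet_ball (x := z) (ε := r)), ← setLIntegral_one]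
  gcongr with w
  rw [enorm_weighted_normalizedKernel_sq, ENNReal.ofReal_le_one, Real.exp_le_one_iff]
  have := sq_nonneg ‖w - z‖
  linarith

theorem areaMeasure_ball (z : ℂ) (r : ℝ) : areaMeasure (ball z r) = ENNReal.ofReal r ^ 2 := by
  have hpi : ENNReal.ofReal Real.pi⁻¹ * NNReal.pi = 1 := by
    rw [← ENNReal.ofReal_coe_nnreal, NNReal.coe_real_pi, ← ENNReal.ofReal_mul (by positivity),
      inv_mul_cancel₀ Real.pi_ne_zero, ENNReal.ofReal_one]
  rw [areaMeasure, Measure.smul_apply, Complex.volume_ball, smul_eq_mul, mul_left_comm, hpi,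
    mul_one]

theorem IsReverseCarleson.of_smul_le {μ ν : Measure ℂ} {c : ℝ≥0∞} (hμ : IsReverseCarleson μ)
    (hc : c ≠ 0) (h : c • μ ≤ ν) : IsReverseCarleson ν := by
  obtain ⟨C, hC, hCarl⟩ := isReverseCarleson_iff.mp hμ
  refine isReverseCarleson_iff.mpr ⟨c * C, mul_ne_zero hc hC, fun f hf hL => ?_⟩
  calc c * C * ∫⁻ w, ‖weighted f w‖ₑ ^ 2 ∂areaMeasure
      ≤ c * ∫⁻ w, ‖weighted f w‖ₑ ^ 2 ∂μ := by
        rw [mul_assoc]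
        gcongr
        exact hCarl f hf hL
    _ = ∫⁻ w, ‖weighted f w‖ₑ ^ 2 ∂(c • μ) := by rw [lintegral_smul_measure, smul_eq_mul]
    _ ≤ ∫⁻ w, ‖weighted f w‖ₑ ^ 2 ∂ν := lintegral_mono' h le_rfl

theorem IsReverseCarleson.exists_le_berezinMeasure {μ : Measure ℂ} (hμ : IsReverseCarleson μ) :
    ∃ δ : ℝ, 0 < δ ∧ ∀ z, ENNReal.ofReal δ ≤ berezinMeasure μ z := by
  obtain ⟨C, hC, hCarl⟩ := hμ
  simp only [← enorm_weighted_sq] at hCarl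
  refine ⟨C, hC, fun z => ?_⟩
  have h := hCarl _ (differentiable_normalizedKernel z) (memLp_normalizedKernel z)
  rw [lintegral_enorm_weighted_normalizedKernel_sq] at h
  rwa [berezinMeasure_eq_lintegral_weighted, mul_comm, ← div_eq_mul_inv,
    ENNReal.le_div_iff_mul_le (by simp) (by simp)]

theorem reverseCarlesonCondition_of_le_berezinMeasure {μ : Measure ℂ} {M : ℝ≥0∞} (hM : M ≠ ∞)
    (hμ : μ ≤ M • areaMeasure) {δ : ℝ} (hδ : 0 < δ)
    (h : ∀ z, ENNReal.ofReal δ ≤ berezinMeasure μ z) : ReverseCarlesonCondition μ := by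
  obtain ⟨r, hr, htail⟩ := exists_setLIntegral_compl_ball_normalizedKernel_le
    (ENNReal.div_ne_zero.mpr ⟨(ENNReal.ofReal_pos.mpr hδ).ne', hM⟩)
  have hlower : ∀ z, ENNReal.ofReal δ ≤ μ (ball z r) := fun z => by
    have htailμ : ∫⁻ w in (ball z r)ᶜ, ‖weighted (normalizedKernel z) w‖ₑ ^ 2 ∂μ ≤
        ENNReal.ofReal δ := by
      calc _ ≤ ∫⁻ w in (ball z r)ᶜ, ‖weighted (normalizedKernel z) w‖ₑ ^ 2 ∂(M • areaMeasure) :=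
            lintegral_mono' (Measure.restrict_mono le_rfl hμ) le_rfl
        _ ≤ M * (ENNReal.ofReal δ / M) := by
            rw [Measure.restrict_smul, lintegral_smul_measure, smul_eq_mul]
            gcongr
            exact htail z
        _ ≤ ENNReal.ofReal δ := ENNReal.mul_div_le
    refine (ENNReal.add_le_add_iff_right (a := ENNReal.ofReal δ) ENNReal.ofReal_ne_top).mp ?_
    calc ENNReal.ofReal δ + ENNReal.ofReal δ = 2 * ENNReal.ofReal δ := (two_mul _).symm
      _ ≤ 2 * berezinMeasure μ z := by
          gcongr
          exact h z
      _ ≤ μ (ball z r) + ENNReal.ofReal δ := (two_mul_berezinMeasure_le μ z r).trans (by gcongr)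
  have hupper : ∀ z, μ (ball z r) ≤ M * ENNReal.ofReal r ^ 2 := fun z => by
    simpa only [Measure.smul_apply, smul_eq_mul, areaMeasure_ball] using hμ (ball z r)
  have hfinite : M * ENNReal.ofReal r ^ 2 ≠ ∞ := by finiteness
  refine ⟨r, hr, max δ⁻¹ (M * ENNReal.ofReal r ^ 2).toReal, lt_max_of_lt_left (by positivity),
    fun z => ⟨(ENNReal.ofReal_le_ofReal ?_).trans (hlower z), (hupper z).trans ?_⟩⟩
  · exact inv_le_of_inv_le₀ hδ (le_max_left _ _)
  · exact (ENNReal.ofReal_toReal hfinite).ge.trans (ENNReal.ofReal_le_ofReal (le_max_right _ _))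

theorem setLIntegral_ofReal_le_add {α : Type*} [MeasurableSpace α] (ν : Measure α) (φ : α → ℝ)
    (s : ℝ) {B : Set α} (hB : MeasurableSet B) :
    ∫⁻ x in B, ENNReal.ofReal (φ x) ∂ν ≤
      eLpNorm φ ∞ ν * ν ({x | s < φ x} ∩ B) + ENNReal.ofReal s * ν B := by
  calc ∫⁻ x in B, ENNReal.ofReal (φ x) ∂ν
      ≤ ∫⁻ x in B, {x | s < φ x}.indicator (fun _ => eLpNorm φ ∞ ν) x + ENNReal.ofReal s ∂ν := by
        refine lintegral_mono_ae (ae_restrict_of_ae ?_)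
        filter_upwards [enorm_ae_le_eLpNormEssSup φ ν] with x hx
        by_cases hxs : x ∈ {x | s < φ x}
        · rw [indicator_of_mem hxs]
          exact ((Real.ofReal_le_enorm _).trans hx).trans le_self_add
        · exact (ENNReal.ofReal_le_ofReal (not_lt.mp hxs)).trans le_add_self
    _ ≤ eLpNorm φ ∞ ν * ν ({x | s < φ x} ∩ B) + ENNReal.ofReal s * ν B := by
        rw [lintegral_add_right _ measurable_const, setLIntegral_const,
          ← Measure.restrict_apply' hB]
        gcongr
        exact lintegral_indicator_const_le _ _

section Invertibility

variable {φ : ℂ → ℝ}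

theorem exists_isReverseCarleson_restrict_of_condition (hφ : eLpNorm φ ∞ areaMeasure ≠ ∞)
    (h : ReverseCarlesonCondition (symbolMeasure φ)) :
    ∃ r : ℝ, 0 < r ∧ IsReverseCarleson (areaMeasure.restrict {z : ℂ | r < φ z}) := by
  obtain ⟨R, hR, C, hC, hball⟩ := h
  have hsum : ENNReal.ofReal (C⁻¹ / 2) + ENNReal.ofReal (C⁻¹ / 2) = ENNReal.ofReal C⁻¹ := by
    rw [← ENNReal.ofReal_add (by positivity) (by positivity), add_halves]
  refine ⟨C⁻¹ / 2 / R ^ 2, by positivity, isReverseCarleson_restrict_of_le_areaMeasure_inter_ball hR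
    (δ := ENNReal.ofReal (C⁻¹ / 2) / eLpNorm φ ∞ areaMeasure)
    (ENNReal.div_ne_zero.mpr ⟨(ENNReal.ofReal_pos.mpr (by positivity)).ne', hφ⟩)
    fun z => ENNReal.div_le_of_le_mul' ?_⟩
  refine (ENNReal.add_le_add_iff_right (a := ENNReal.ofReal (C⁻¹ / 2)) ENNReal.ofReal_ne_top).mp ?_
  have hsmall : ENNReal.ofReal (C⁻¹ / 2 / R ^ 2) * areaMeasure (ball z R) =
      ENNReal.ofReal (C⁻¹ / 2) := by
    rw [areaMeasure_ball, ← ENNReal.ofReal_pow hR.le, ← ENNReal.ofReal_mul (by positivity),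
      div_mul_cancel₀ _ (by positivity)]
  have hmass := (hball z).1
  rw [withDensity_apply _ measurableSet_ball] at hmass
  rw [hsum, ← hsmall]
  exact hmass.trans (setLIntegral_ofReal_le_add _ _ _ measurableSet_ball)

theorem isUnit_toeplitz_of_isReverseCarleson (hφ : MemLp φ ∞ areaMeasure)
    (hφ0 : ∀ᵐ z ∂areaMeasure, 0 ≤ φ z) (h : IsReverseCarleson (symbolMeasure φ)) :
    IsUnit (toeplitz (fun z => (φ z : ℂ)) hφ.ofReal) := by
  obtain ⟨C, hC, hCarl⟩ := h
  simp only [← enorm_weighted_sq] at hCarl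
  refine ContinuousLinearMap.isUnit_of_forall_le_norm_inner_map _ (c := ⟨C, hC.le⟩) hC
    fun f => ?_
  rw [norm_inner_symm, inner_toeplitz_self hφ, Complex.norm_real,
    ← ENNReal.ofReal_le_ofReal_iff (norm_nonneg _)]
  calc ENNReal.ofReal (‖f‖ ^ 2 * C)
      = 2⁻¹ * (ENNReal.ofReal C * ∫⁻ w, ‖weighted (entireRep f) w‖ₑ ^ 2 ∂areaMeasure) := by
        rw [mul_comm, ENNReal.ofReal_mul hC.le, ENNReal.ofReal_pow (norm_nonneg _), ofReal_norm,
          enorm_sq_eq_lintegral_weighted, mul_left_comm]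
    _ ≤ 2⁻¹ * ∫⁻ w, ‖weighted (entireRep f) w‖ₑ ^ 2 ∂symbolMeasure φ := by
        gcongr
        exact hCarl _ (differentiable_entireRep f) (memLp_entireRep f)
    _ = ENNReal.ofReal (∫ w, φ w * ‖entireRep f w‖ ^ 2 ∂gaussianMeasure) :=
        (ofReal_integral_symbol_mul hφ hφ0 (differentiable_entireRep f).continuous
          (memLp_entireRep f)).symm
    _ ≤ _ := ENNReal.ofReal_le_ofReal (Real.le_norm_self _)

theorem isReverseCarleson_of_isUnit_toeplitz (hφ : MemLp φ ∞ areaMeasure)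
    (hφ0 : ∀ᵐ z ∂areaMeasure, 0 ≤ φ z)
    (hT : IsUnit (toeplitz (fun z => (φ z : ℂ)) hφ.ofReal)) :
    IsReverseCarleson (symbolMeasure φ) := by
  set T := toeplitz (fun z => (φ z : ℂ)) hφ.ofReal
  obtain ⟨K, hK⟩ := ContinuousLinearMap.antilipschitz_of_isEmbedding _
    (ContinuousLinearMap.isHomeomorph_of_isUnit hT).isEmbedding
  have hbelow : ∀ f, ‖f‖ₑ ≤ K * ‖T f‖ₑ := fun f => by
    simpa only [map_zero, edist_zero_right] using hK f 0
  set M := eLpNorm φ ∞ areaMeasure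
  have hfinite : (K : ℝ≥0∞) ^ 2 * M ≠ ∞ := ENNReal.mul_ne_top (by finiteness) hφ.2.ne
  refine isReverseCarleson_iff.mpr ⟨(K ^ 2 * M)⁻¹, ENNReal.inv_ne_zero.mpr hfinite,
    fun f hf hL => ?_⟩
  set F := ofEntire f hf hL
  have hF : entireRep F = f := entireRep_ofEntire hf hL
  rw [mul_comm, ← div_eq_mul_inv]
  refine ENNReal.div_le_of_le_mul' ?_
  refine (ENNReal.mul_le_mul_iff_right (a := 2⁻¹) (by simp) (by simp)).mp ?_
  calc 2⁻¹ * ∫⁻ w, ‖weighted f w‖ₑ ^ 2 ∂areaMeasure = ‖F‖ₑ ^ 2 := by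
        rw [enorm_sq_eq_lintegral_weighted, hF]
    _ ≤ K ^ 2 * ‖T F‖ₑ ^ 2 := by
        rw [← mul_pow]
        gcongr
        exact hbelow F
    _ ≤ K ^ 2 * (M * (2⁻¹ * ∫⁻ w, ‖weighted f w‖ₑ ^ 2 ∂symbolMeasure φ)) := by
        rw [← hF]
        gcongr
        exact enorm_toeplitz_sq_le_symbolMeasure hφ hφ0 F
    _ = 2⁻¹ * (K ^ 2 * M * ∫⁻ w, ‖weighted f w‖ₑ ^ 2 ∂symbolMeasure φ) := by ring

theorem exists_le_berezin_of_isReverseCarleson (hφ : MemLp φ ∞ areaMeasure)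
    (hφ0 : ∀ᵐ z ∂areaMeasure, 0 ≤ φ z) (h : IsReverseCarleson (symbolMeasure φ)) :
    ∃ δ : ℝ, 0 < δ ∧ ∀ z : ℂ, δ ≤ berezin φ z := by
  obtain ⟨δ, hδ, hle⟩ := h.exists_le_berezinMeasure
  refine ⟨δ, hδ, fun z => ?_⟩
  have hz := hle z
  rw [berezinMeasure_symbolMeasure hφ hφ0, ENNReal.ofReal_le_ofReal_iff'] at hz
  exact hz.resolve_right hδ.not_ge

theorem reverseCarlesonCondition_of_le_berezin (hφ : MemLp φ ∞ areaMeasure)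
    (hφ0 : ∀ᵐ z ∂areaMeasure, 0 ≤ φ z) (h : ∃ δ : ℝ, 0 < δ ∧ ∀ z : ℂ, δ ≤ berezin φ z) :
    ReverseCarlesonCondition (symbolMeasure φ) := by
  obtain ⟨δ, hδ, hle⟩ := h
  refine reverseCarlesonCondition_of_le_berezinMeasure hφ.2.ne (symbolMeasure_le_smul φ) hδ
    fun z => ?_
  rw [berezinMeasure_symbolMeasure hφ hφ0]
  exact ENNReal.ofReal_le_ofReal (hle z)

theorem isReverseCarleson_of_restrict (hφ : AEMeasurable φ areaMeasure)
    (h : ∃ r : ℝ, 0 < r ∧ IsReverseCarleson (areaMeasure.restrict {z : ℂ | r < φ z})) :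
    IsReverseCarleson (symbolMeasure φ) := by
  obtain ⟨r, hr, hCarl⟩ := h
  exact hCarl.of_smul_le (ENNReal.ofReal_pos.mpr hr).ne' (smul_restrict_le_symbolMeasure hφ r)

end Invertibility

end Fock
end

theorem mainTheorem7 (φ : ℂ → ℝ) (hφ : MemLp φ ∞ Fock.areaMeasure)
    (hφ_nonneg : ∀ᵐ z ∂Fock.areaMeasure, 0 ≤ φ z)
    (μ : Measure ℂ) (hμ : μ = Fock.areaMeasure.withDensity fun z => ENNReal.ofReal (φ z)) :
    -- the operator and the transform of `μ` are those of `φ`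
    (∀ (f : Fock.fockSpace) (z : ℂ),
      Integrable (Fock.toeplitzIntegrand (Fock.entireRep f) z) μ ∧
      Fock.entireRep (Fock.toeplitz (fun z => (φ z : ℂ)) hφ.ofReal f) z =
        Fock.toeplitzMeasure μ (Fock.entireRep f) z) ∧
    (∀ z : ℂ, Fock.berezinMeasure μ z = ENNReal.ofReal (Fock.berezin φ z)) ∧
    List.TFAE [
      IsUnit (Fock.toeplitz (fun z => (φ z : ℂ)) hφ.ofReal),
      ∃ δ : ℝ, 0 < δ ∧ ∀ z : ℂ, δ ≤ Fock.berezin φ z,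
      ∃ r : ℝ, 0 < r ∧ Fock.IsReverseCarleson (Fock.areaMeasure.restrict {z : ℂ | r < φ z}),
      Fock.IsReverseCarleson μ,
      Fock.ReverseCarlesonCondition μ] := by
  subst hμ
  refine ⟨fun f z => ⟨Fock.integrable_toeplitzIntegrand hφ hφ_nonneg f z,
    Fock.entireRep_toeplitz_eq_toeplitzMeasure hφ hφ_nonneg f z⟩,
    Fock.berezinMeasure_symbolMeasure hφ hφ_nonneg, ?_⟩
  tfae_have 1 → 4 := Fock.isReverseCarleson_of_isUnit_toeplitz hφ hφ_nonneg
  tfae_have 4 → 1 := Fock.isUnit_toeplitz_of_isReverseCarleson hφ hφ_nonneg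
  tfae_have 4 → 2 := Fock.exists_le_berezin_of_isReverseCarleson hφ hφ_nonneg
  tfae_have 2 → 5 := Fock.reverseCarlesonCondition_of_le_berezin hφ hφ_nonneg
  tfae_have 5 → 3 := Fock.exists_isReverseCarleson_restrict_of_condition hφ.2.ne
  tfae_have 3 → 4 := Fock.isReverseCarleson_of_restrict hφ.1.aemeasurable
  tfae_finish
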